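/- Let $K$ be a finite field extension of $\mathbb{Q}_2$. Write $\mathcal{O}_K$ for its ring of integers, $\mathfrak{p}_K$ for the maximal ideal of $\mathcal{O}_K$, $q = \#(\mathcal{O}_K/\mathfrak{p}_K)$ for the size of the residue field, $e_K = e(K/\mathbb{Q}_2)$ for the absolute ramification index, and $v_K$ for the valuation normalised so that $v_K(\mathfrak{p}_K) = 1$. Let $\Sigma^{V_4}$ be the set of $K$-isomorphism classes of totally ramified quartic field extensions $L/K$ such that $\operatorname{Gal}(\widetilde{L}/K) \cong V_4 = C_2 \times C_2$, where $\widetilde{L}$ is the normal closure of $L$ over $K$. For a set $S$ of isomorphism classes of finite extensions of $K$, define its mass $$\widetilde{m}(S) = \sum_{L \in S} \frac{(\#\operatorname{Aut}(L/K))^{-1}}{q^{v_K(d_{L/K})}},$$ where $d_{L/K}$ is the discriminant ideal of $L/K$. Then $\Sigma^{V_4}$ is finite and $$ \widetilde{m}(\Sigma^{V_4}) = \frac{q-1}{6}\cdot \Big(q^{-4e_K-3}\cdot \frac{q^{4e_K} - 1}{q^4 - 1} \cdot (3q^3 + q^2 + q + 3) - 3 q^{-3e_K - 3}\cdot \frac{q^{3e_K}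 - 1}{q^3 - 1} \cdot (q^2 + 1)\Big). $$ -/

import Mathlib

open IntermediateField

noncomputable section

namespace TwoAdic

/-! ### Rings of integers of `2`-adic fields -/

section Integers

variable (F : Type*) [Field F] [Algebra ℤ_[2] F]

/-- The ring of integers `𝒪_F` of an algebraic extension `F` of `ℚ₂`: the integral closure of
`ℤ₂` in `F`. -/
abbrev Integers : Subalgebra ℤ_[2] F := integralClosure ℤ_[2] F

variable [Algebra ℚ_[2] F] [IsScalarTower ℤ_[2] ℚ_[2] F] [Algebra.IsAlgebraic ℚ_[2] F]

/-- The integral elements are those of spectral norm at most `1`. -/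
theorem mem_integers_iff (x : F) : x ∈ Integers F ↔ spectralNorm ℚ_[2] F x ≤ 1 := by
  have hx : IsIntegral ℚ_[2] x := Algebra.IsIntegral.isIntegral x
  rw [mem_integralClosure_iff, spectralNorm, spectralValue_le_one_iff (minpoly.monic hx)]
  constructor
  · intro h n
    rw [minpoly.isIntegrallyClosed_eq_field_fractions' ℚ_[2] h, Polynomial.coeff_map]
    exact PadicInt.norm_le_one _
  · intro h
    have hl : minpoly ℚ_[2] x ∈ Polynomial.lifts (algebraMap ℤ_[2] ℚ_[2]) := by
      rw [Polynomial.lifts_iff_coeff_lifts]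
      intro n
      exact ⟨⟨_, h n⟩, rfl⟩
    obtain ⟨g, hg, -, hgm⟩ := Polynomial.lifts_and_degree_eq_and_monic hl (minpoly.monic hx)
    refine ⟨g, hgm, ?_⟩
    rw [IsScalarTower.algebraMap_eq ℤ_[2] ℚ_[2] F, ← Polynomial.eval₂_map, hg]
    exact minpoly.aeval _ _

instance isLocalRing_integers : IsLocalRing (Integers F) := by
  have hmul : ∀ x y : F, spectralNorm ℚ_[2] F (x * y) =
      spectralNorm ℚ_[2] F x * spectralNorm ℚ_[2] F y := spectralAlgNorm_mul
  have key : ∀ a : Integers F, a ∈ nonunits (Integers F) ↔ spectralNorm ℚ_[2] F (a : F) < 1 := by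
    intro a
    have ha := (mem_integers_iff F a).1 a.2
    rw [mem_nonunits_iff]
    constructor
    · intro h
      refine lt_of_le_of_ne ha fun h1 ↦ h ?_
      have h0 : (a : F) ≠ 0 := by
        intro h0
        rw [h0, spectralNorm_zero] at h1
        exact zero_ne_one h1
      have hm := hmul (a : F) (a : F)⁻¹
      rw [mul_inv_cancel₀ h0, spectralNorm_one, h1, one_mul] at hm
      exact IsUnit.of_mul_eq_one ⟨(a : F)⁻¹, (mem_integers_iff F _).2 hm.symm.le⟩
        (Subtype.ext (mul_inv_cancel₀ h0))
    · rintro h ⟨u, rfl⟩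
      have hm := hmul ((u : Integers F) : F) (((u⁻¹ : (Integers F)ˣ) : Integers F) : F)
      have h1 : (((u : Integers F) : F) * (((u⁻¹ : (Integers F)ˣ) : Integers F) : F)) = 1 := by
        rw [← Subalgebra.coe_mul, Units.mul_inv, Subalgebra.coe_one]
      rw [h1, spectralNorm_one] at hm
      have hu := (mem_integers_iff F _).1 ((u⁻¹ : (Integers F)ˣ) : Integers F).2
      have hn := spectralNorm_nonneg (K := ℚ_[2]) ((u : Integers F) : F)
      nlinarith
  refine IsLocalRing.of_nonunits_add fun a b ha hb ↦ ?_
  rw [key] at *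
  exact (isNonarchimedean_spectralNorm (K := ℚ_[2]) (L := F) (a : F) (b : F)).trans_lt
    (max_lt ha hb)

/-- The maximal ideal `𝔭_F` of `𝒪_F`. -/
def maxIdeal : Ideal (Integers F) := IsLocalRing.maximalIdeal (Integers F)

/-- The cardinality `q_F` of the residue field `𝒪_F / 𝔭_F`. -/
def residueCard : ℕ := Nat.card (Integers F ⧸ maxIdeal F)

/-- The absolute ramification index `e_F = e(F / ℚ₂)`. -/
def absRamificationIdx : ℕ := (maxIdeal F).ramificationIdx ℤ_[2]

end Integers

/-! ### Ramification and discriminants of extensions of `2`-adic fields -/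

section Extension

variable (K L : Type*) [Field K] [Field L] [Algebra ℤ_[2] K] [Algebra ℤ_[2] L]
  [Algebra K L] [IsScalarTower ℤ_[2] K L]

/-- The inclusion `𝒪_K → 𝒪_L` for an extension `L / K`. -/
def integersMap : Integers K →+* Integers L :=
  (((IsScalarTower.toAlgHom ℤ_[2] K L).comp (Integers K).val).codRestrict (Integers L)
    (fun x ↦ x.2.map (IsScalarTower.toAlgHom ℤ_[2] K L))).toRingHom

/-- `L / K` is totally ramified: `e(L / K) = [L : K]`. -/
def IsTotallyRamified [Algebra ℚ_[2] L] [IsScalarTower ℤ_[2] ℚ_[2] L]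
    [Algebra.IsAlgebraic ℚ_[2] L] : Prop :=
  letI := (integersMap K L).toAlgebra
  (maxIdeal L).ramificationIdx (Integers K) = Module.finrank K L

/-- The discriminant ideal `d_{L/K}`: the ideal of `𝒪_K` generated by the discriminants of all
`K`-bases of `L` that consist of elements of `𝒪_L`. -/
def discrIdeal : Ideal (Integers K) :=
  Ideal.span {d | ∃ b : Module.Basis (Fin (Module.finrank K L)) K L,
    (∀ i, b i ∈ Integers L) ∧ (d : K) = Algebra.discr K b}

/-- The valuation `v_K(d_{L/K})`: the exponent of `𝔭_K` in the discriminant ideal. -/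
def discrVal [Algebra ℚ_[2] K] [IsScalarTower ℤ_[2] ℚ_[2] K] [Algebra.IsAlgebraic ℚ_[2] K] : ℕ :=
  multiplicity (maxIdeal K) (discrIdeal K L)

variable {K L} in
/-- The discriminant ideal depends only on the isomorphism class of the extension. -/
theorem discrIdeal_le_of_algEquiv {M : Type*} [Field M] [Algebra ℤ_[2] M]
    [Algebra K M] [IsScalarTower ℤ_[2] K M] (f : L ≃ₐ[K] M) :
    discrIdeal K L ≤ discrIdeal K M := by
  refine Ideal.span_mono ?_
  rintro d ⟨b, hb, hd⟩
  have hr : Module.finrank K L = Module.finrank K M := f.toLinearEquiv.finrank_eq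
  refine ⟨(b.map f.toLinearEquiv).reindex (finCongr hr), fun i ↦ ?_, ?_⟩
  · rw [mem_integralClosure_iff, Module.Basis.reindex_apply, Module.Basis.map_apply]
    exact (hb ((finCongr hr).symm i)).map (f.toAlgHom.restrictScalars ℤ_[2])
  · rw [hd, Module.Basis.coe_reindex, Algebra.discr_reindex, Algebra.discr_eq_discr_of_algEquiv b f]
    rfl

end Extension

/-! ### Isomorphism classes of extensions and their mass -/

section Mass

variable (K : Type*) [Field K]

/-- Two extensions of `K` inside the algebraic closure are identified if they are isomorphic
over `K`. -/
instance extSetoid : Setoid (IntermediateField K (AlgebraicClosure K)) where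
  r L M := Nonempty (L ≃ₐ[K] M)
  iseqv := ⟨fun _ ↦ ⟨AlgEquiv.refl⟩, fun ⟨f⟩ ↦ ⟨f.symm⟩, fun ⟨f⟩ ⟨g⟩ ↦ ⟨f.trans g⟩⟩

/-- The isomorphism classes of algebraic extensions `L / K`, each of which is represented inside
the algebraic closure of `K`. -/
def ExtClass : Type _ := Quotient (extSetoid K)

variable {K} in
/-- The Galois closure group of `L / K` is isomorphic to `G`: `Gal(L̃ / K) ≅ G`, where `L̃` is the
normal closure of `L` over `K`. -/
def HasGaloisClosureGroup (L : IntermediateField K (AlgebraicClosure K)) (G : Type*) [Group G] :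
    Prop :=
  Nonempty (Gal(normalClosure K L (AlgebraicClosure K)/K) ≃* G)

/-- The Klein four-group. -/
abbrev V4 : Type := Multiplicative (ZMod 2) × Multiplicative (ZMod 2)

variable [Algebra ℤ_[2] K] [Algebra ℚ_[2] K] [IsScalarTower ℤ_[2] ℚ_[2] K]
  [Algebra.IsAlgebraic ℚ_[2] K]

instance isScalarTower_intermediateField (L : IntermediateField K (AlgebraicClosure K)) :
    IsScalarTower ℤ_[2] ℚ_[2] L := by
  refine IsScalarTower.of_algebraMap_eq' ?_
  rw [IsScalarTower.algebraMap_eq ℤ_[2] K L, IsScalarTower.algebraMap_eq ℚ_[2] K L,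
    IsScalarTower.algebraMap_eq ℤ_[2] ℚ_[2] K, RingHom.comp_assoc]

instance isAlgebraic_intermediateField (L : IntermediateField K (AlgebraicClosure K)) :
    Algebra.IsAlgebraic ℚ_[2] L :=
  Algebra.IsAlgebraic.trans ℚ_[2] K L

/-- `Σ^G`: the set of isomorphism classes of totally ramified quartic extensions `L / K` whose
Galois closure group is isomorphic to `G`. -/
def totRamQuartics (G : Type*) [Group G] : Set (ExtClass K) :=
  {c | ∃ L : IntermediateField K (AlgebraicClosure K), Quotient.mk (extSetoid K) L = c ∧
    Module.finrank K L = 4 ∧ IsTotallyRamified K L ∧ HasGaloisClosureGroup L G}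

/-- The term `(#Aut(L/K))⁻¹ / q ^ v_K(d_{L/K})` of the isomorphism class of `L`. -/
def massTerm (c : ExtClass K) : ℝ :=
  Quotient.lift (fun L : IntermediateField K (AlgebraicClosure K) ↦
    (Nat.card Gal(L/K) : ℝ)⁻¹ / (residueCard K : ℝ) ^ discrVal K L)
    (by
      rintro L M ⟨f⟩
      have h1 : Nat.card Gal(L/K) = Nat.card Gal(M/K) :=
        Nat.card_congr (AlgEquiv.autCongr f).toEquiv
      have h2 : discrIdeal K L = discrIdeal K M :=
        le_antisymm (discrIdeal_le_of_algEquiv f) (discrIdeal_le_of_algEquiv f.symm)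
      simp only [h1, discrVal, h2]) c

/-- The mass `m̃(S) = ∑_{L ∈ S} (#Aut(L/K))⁻¹ / q ^ v_K(d_{L/K})`. -/
def mass (S : Set (ExtClass K)) : ℝ := ∑' c : S, massTerm K c

end Mass

end TwoAdic

end

/-!
By Kummer theory the `V₄`-extensions of `K` are the fields `K(√v, √w)` for independent square
classes `v` and `w`, and such a field is generated by exactly six ordered pairs, namely the pairs
of distinct elements of `{v, w, v * w}`. Filter `Kˣ / Kˣ²` by the images of the higher unit
groups. An even unit group `U²ʲ` has the same image as `U²ʲ⁺¹` for `2 * j < 2 * e`, because the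
residue field is perfect, so there are `e + 1` steps besides the whole group, and the position of
`v` determines the discriminant exponent of `K(√v)`. The smallest step consists of the classes
`v` for which `K(√v)` is unramified; `K(√v, √w)` is totally ramified if and only if none of `v`,
`w`, `v * w` belongs to it, and then its discriminant exponent is the sum of those of its three
quadratic subfields.

Hence, if `f v` denotes `q ^ (-d v)` with `d v` the discriminant exponent of `K(√v)`, and zero
when `K(√v)` is unramified, then the mass is `1 / (4 * 6)` times the sum of
`f v * f w * f (v * w)` over all pairs. Since `f` is constant on the successive differences of the
filtration, this sum is evaluated by recursion along the filtration.
-/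

noncomputable section

namespace TwoAdic

section AbsoluteValue

variable (F : Type*) [Field F] [Algebra ℚ_[2] F]

theorem charZero_of_algebra_padic : CharZero F :=
  charZero_of_injective_algebraMap (algebraMap ℚ_[2] F).injective

theorem two_ne_zero_of_algebra_padic : (2 : F) ≠ 0 :=
  have := charZero_of_algebra_padic F
  two_ne_zero

/-- The absolute value of an algebraic extension of `ℚ₂` that extends the one of `ℚ₂`, bundled from
Mathlib's spectral norm. -/
def absVal [Algebra.IsAlgebraic ℚ_[2] F] : AbsoluteValue F ℝ where
  toFun := spectralNorm ℚ_[2] F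
  map_mul' := spectralAlgNorm_mul
  nonneg' := spectralNorm_nonneg
  eq_zero' x := ⟨fun h ↦ eq_zero_of_map_spectralNorm_eq_zero h (Algebra.IsAlgebraic.isAlgebraic x),
    fun h ↦ h ▸ spectralNorm_zero⟩
  add_le' x y := (isNonarchimedean_spectralNorm x y).trans
    (max_le_add_of_nonneg (spectralNorm_nonneg _) (spectralNorm_nonneg _))

variable {F}

theorem absVal_algEquiv {L : Type*} [Field L] [Algebra ℚ_[2] L] [Algebra.IsAlgebraic ℚ_[2] L]
    [Algebra F L] [IsScalarTower ℚ_[2] F L] (σ : Gal(L/F)) (x : L) :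
    absVal L (σ x) = absVal L x :=
  (spectralNorm_eq_of_equiv (σ.restrictScalars ℚ_[2]) x).symm

variable [Algebra.IsAlgebraic ℚ_[2] F]

theorem absVal_isNonarchimedean : IsNonarchimedean (absVal F) :=
  isNonarchimedean_spectralNorm

theorem absVal_add_le (x y : F) : absVal F (x + y) ≤ max (absVal F x) (absVal F y) :=
  absVal_isNonarchimedean x y

theorem absVal_sub_le (x y : F) : absVal F (x - y) ≤ max (absVal F x) (absVal F y) := by
  rw [sub_eq_add_neg, ← (absVal F).map_neg y]
  exact absVal_add_le _ _

theorem absVal_add_of_lt {x y : F} (h : absVal F x < absVal F y) :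
    absVal F (x + y) = absVal F y :=
  absVal_isNonarchimedean.add_eq_right_of_lt h

theorem absVal_algebraMap {L : Type*} [Field L] [Algebra ℚ_[2] L] [Algebra.IsAlgebraic ℚ_[2] L]
    [Algebra F L] [IsScalarTower ℚ_[2] F L] (x : F) : absVal L (algebraMap F L x) = absVal F x :=
  (spectralNorm.eq_of_tower x).symm

theorem absVal_two_pos : 0 < absVal F 2 :=
  (absVal F).pos (two_ne_zero_of_algebra_padic F)

theorem absVal_two_lt_one : absVal F 2 < 1 := by
  have h : absVal F (algebraMap ℚ_[2] F 2) = ‖(2 : ℚ_[2])‖ := spectralNorm_extends _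
  rw [← map_ofNat (algebraMap ℚ_[2] F) 2, h]
  exact_mod_cast Padic.norm_p_lt_one (p := 2)

variable [Algebra ℤ_[2] F] [IsScalarTower ℤ_[2] ℚ_[2] F]

theorem mem_integers_iff_absVal (x : F) : x ∈ Integers F ↔ absVal F x ≤ 1 := mem_integers_iff F x

theorem absVal_le_one_of_integers (x : Integers F) : absVal F x ≤ 1 :=
  (mem_integers_iff_absVal _).1 x.2

theorem isUnit_integers_iff (x : Integers F) : IsUnit x ↔ absVal F x = 1 := by
  rw [isUnit_iff_exists_inv]
  constructor
  · rintro ⟨y, hxy⟩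
    have h : absVal F x * absVal F y = 1 := by
      rw [← map_mul, ← Subalgebra.coe_mul, hxy, Subalgebra.coe_one, map_one]
    refine le_antisymm (absVal_le_one_of_integers x) ?_
    rw [← h]
    exact mul_le_of_le_one_right ((absVal F).nonneg _) (absVal_le_one_of_integers y)
  · intro h
    have hx : (x : F) ≠ 0 := (absVal F).pos_iff.1 (h ▸ one_pos)
    exact ⟨⟨(x : F)⁻¹, (mem_integers_iff_absVal _).2 (by rw [map_inv₀, h, inv_one])⟩,
      Subtype.ext (mul_inv_cancel₀ hx)⟩

theorem mem_maxIdeal_iff (x : Integers F) : x ∈ maxIdeal F ↔ absVal F x < 1 := by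
  rw [maxIdeal, IsLocalRing.mem_maximalIdeal, mem_nonunits_iff, isUnit_integers_iff]
  exact ⟨(absVal_le_one_of_integers x).lt_of_ne, fun h ↦ h.ne⟩

theorem mem_span_iff_absVal_le (x d : Integers F) :
    x ∈ Ideal.span {d} ↔ absVal F x ≤ absVal F d := by
  rw [Ideal.mem_span_singleton]
  constructor
  · rintro ⟨c, rfl⟩
    rw [Subalgebra.coe_mul, map_mul]
    exact mul_le_of_le_one_right ((absVal F).nonneg _) (absVal_le_one_of_integers c)
  · intro h
    rcases eq_or_ne (d : F) 0 with hd | hd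
    · rw [hd, map_zero] at h
      have hx : x = 0 := Subtype.ext ((absVal F).eq_zero.1 (le_antisymm h ((absVal F).nonneg _)))
      exact hx ▸ dvd_zero _
    · refine ⟨⟨x / d, (mem_integers_iff_absVal _).2 ?_⟩, Subtype.ext (mul_div_cancel₀ _ hd).symm⟩
      rw [map_div₀]
      exact div_le_one_of_le₀ h ((absVal F).nonneg _)

theorem not_isField_integers : ¬ IsField (Integers F) := by
  intro h
  obtain ⟨b, hb⟩ := h.mul_inv_cancel (a := (2 : Integers F)) fun h ↦
    two_ne_zero_of_algebra_padic F congr(($h : F))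
  exact absVal_two_lt_one.ne ((isUnit_integers_iff (2 : Integers F)).1 (IsUnit.of_mul_eq_one b hb))

instance isMaximal_maxIdeal : (maxIdeal F).IsMaximal := IsLocalRing.maximalIdeal.isMaximal _

theorem map_under_maxIdeal : ((maxIdeal F).under ℤ_[2]).map (algebraMap ℤ_[2] (Integers F)) =
    Ideal.span {(2 : Integers F)} := by
  have hu : (maxIdeal F).under ℤ_[2] = IsLocalRing.maximalIdeal ℤ_[2] :=
    IsLocalRing.eq_maximalIdeal inferInstance
  rw [hu, PadicInt.maximalIdeal_eq_span_p, Ideal.map_span, Set.image_singleton, map_natCast,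
    Nat.cast_ofNat]

end AbsoluteValue

section LocalField

variable (K : Type*) [Field K] [Algebra ℚ_[2] K] [FiniteDimensional ℚ_[2] K]
    [Algebra ℤ_[2] K] [IsScalarTower ℤ_[2] ℚ_[2] K]

instance finite_integers : Module.Finite ℤ_[2] (Integers K) :=
  IsIntegralClosure.finite ℤ_[2] ℚ_[2] K (Integers K)

instance isDedekindDomain_integers : IsDedekindDomain (Integers K) :=
  integralClosure.isDedekindDomain ℤ_[2] ℚ_[2] K

instance isDiscreteValuationRing_integers : IsDiscreteValuationRing (Integers K) :=
  ((IsDiscreteValuationRing.TFAE _ not_isField_integers).out 0 2).2 (isDedekindDomain_integers K)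

/-- A uniformizer of a `2`-adic field, as an element of the ring of integers. -/
def uniformizerInt : Integers K := (IsDiscreteValuationRing.exists_irreducible (Integers K)).choose

/-- The uniformizer `uniformizerInt K`, as an element of the field. -/
def uniformizer : K := uniformizerInt K

/-- The absolute value of a uniformizer: the generator below `1` of the value group of `K`. -/
def rho : ℝ := absVal K (uniformizer K)

theorem irreducible_uniformizerInt : Irreducible (uniformizerInt K) :=
  (IsDiscreteValuationRing.exists_irreducible (Integers K)).choose_spec

theorem absVal_uniformizer : absVal K (uniformizer K) = rho K := rfl

theorem maxIdeal_eq_span : maxIdeal K = Ideal.span {uniformizerInt K} :=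
  (irreducible_uniformizerInt K).maximalIdeal_eq

variable {K}

theorem uniformizer_ne_zero : uniformizer K ≠ 0 :=
  fun h ↦ (irreducible_uniformizerInt K).ne_zero (Subtype.ext h)

variable (K)

theorem rho_pos : 0 < rho K := (absVal K).pos uniformizer_ne_zero

theorem rho_lt_one : rho K < 1 :=
  (mem_maxIdeal_iff _).1 (irreducible_uniformizerInt K).not_isUnit

variable {K}

theorem exists_absVal_eq_pow {c : K} (hc : c ≠ 0) (h : absVal K c ≤ 1) :
    ∃ n : ℕ, absVal K c = rho K ^ n := by
  have hc' : (⟨c, (mem_integers_iff_absVal c).2 h⟩ : Integers K) ≠ 0 := fun h ↦ hc congr(($h : K))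
  obtain ⟨n, u, hu⟩ := IsDiscreteValuationRing.eq_unit_mul_pow_irreducible hc'
    (irreducible_uniformizerInt K)
  have hcu : c = ((u : Integers K) : K) * uniformizer K ^ n := congr(($hu : K))
  exact ⟨n, by rw [hcu, map_mul, (isUnit_integers_iff _).1 u.isUnit, one_mul, map_pow, rho]⟩

theorem exists_absVal_eq {c : K} (hc : c ≠ 0) : ∃ n : ℤ, absVal K c = rho K ^ n := by
  rcases le_total (absVal K c) 1 with h | h
  · obtain ⟨n, hn⟩ := exists_absVal_eq_pow hc h
    exact ⟨n, by rw [hn, zpow_natCast]⟩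
  · obtain ⟨n, hn⟩ := exists_absVal_eq_pow (inv_ne_zero hc)
      (by rw [map_inv₀]; exact inv_le_one_of_one_le₀ h)
    exact ⟨-n, by rw [zpow_neg, zpow_natCast, ← hn, map_inv₀, inv_inv]⟩

theorem rho_zpow_le_zpow_iff {m n : ℤ} : rho K ^ m ≤ rho K ^ n ↔ n ≤ m :=
  zpow_le_zpow_iff_right_of_lt_one₀ (rho_pos K) (rho_lt_one K)

theorem rho_zpow_lt_zpow_iff {m n : ℤ} : rho K ^ m < rho K ^ n ↔ n < m :=
  zpow_lt_zpow_iff_right_of_lt_one₀ (rho_pos K) (rho_lt_one K)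

theorem rho_pow_le_rho_pow {m n : ℕ} (h : m ≤ n) : rho K ^ n ≤ rho K ^ m :=
  pow_le_pow_of_le_one (rho_pos K).le (rho_lt_one K).le h

theorem rho_pow_lt_one {n : ℕ} (hn : n ≠ 0) : rho K ^ n < 1 :=
  pow_lt_one₀ (rho_pos K).le (rho_lt_one K) hn

theorem rho_zpow_inj {m n : ℤ} : rho K ^ m = rho K ^ n ↔ m = n :=
  zpow_right_inj₀ (rho_pos K) (rho_lt_one K).ne

theorem absVal_lt_rho_zpow_iff {c : K} {n : ℤ} :
    absVal K c < rho K ^ n ↔ absVal K c ≤ rho K ^ (n + 1) := by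
  rcases eq_or_ne c 0 with rfl | hc
  · simp [zpow_pos (rho_pos K), (zpow_pos (rho_pos K) _).le]
  · obtain ⟨m, hm⟩ := exists_absVal_eq hc
    rw [hm, rho_zpow_le_zpow_iff, rho_zpow_lt_zpow_iff]
    omega

theorem absVal_lt_one_iff {c : K} : absVal K c < 1 ↔ absVal K c ≤ rho K := by
  simpa using absVal_lt_rho_zpow_iff (c := c) (n := 0)

theorem mem_maxIdeal_pow_iff (x : Integers K) (n : ℕ) :
    x ∈ maxIdeal K ^ n ↔ absVal K x ≤ rho K ^ n := by
  rw [maxIdeal_eq_span, Ideal.span_singleton_pow, mem_span_iff_absVal_le, Subalgebra.coe_pow,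
    map_pow]
  rfl

theorem span_eq_maxIdeal_pow {d : Integers K} {n : ℕ} (h : absVal K d = rho K ^ n) :
    Ideal.span {d} = maxIdeal K ^ n := by
  ext x
  rw [mem_span_iff_absVal_le, mem_maxIdeal_pow_iff, h]

theorem maxIdeal_ne_bot : maxIdeal K ≠ ⊥ :=
  IsDiscreteValuationRing.not_a_field _

theorem multiplicity_maxIdeal_pow (n : ℕ) : multiplicity (maxIdeal K) (maxIdeal K ^ n) = n :=
  multiplicity_pow_self maxIdeal_ne_bot
    (fun h ↦ (isMaximal_maxIdeal (F := K)).ne_top (Ideal.isUnit_iff.1 h)) n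

variable (K)

theorem absVal_two : absVal K 2 = rho K ^ absRamificationIdx K := by
  have h2 : Ideal.span {(2 : Integers K)} ≠ ⊥ := by
    rw [Ne, Ideal.span_singleton_eq_bot]
    exact fun h ↦ two_ne_zero_of_algebra_padic K congr(($h : K))
  obtain ⟨n, hn⟩ := exists_absVal_eq_pow (two_ne_zero_of_algebra_padic K) absVal_two_lt_one.le
  have hspan : Ideal.span {(2 : Integers K)} = maxIdeal K ^ n := span_eq_maxIdeal_pow hn
  have h : absRamificationIdx K = n := by
    rw [absRamificationIdx, Ideal.IsDedekindDomain.ramificationIdx_eq_multiplicity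
      ((maxIdeal K).under ℤ_[2]) (maxIdeal K) (map_under_maxIdeal.trans_ne h2),
      map_under_maxIdeal, hspan, multiplicity_maxIdeal_pow]
  rw [hn, h]

theorem absVal_four : absVal K 4 = rho K ^ (2 * absRamificationIdx K) := by
  rw [show (4 : K) = 2 ^ 2 by norm_num, map_pow, absVal_two, ← pow_mul, mul_comm]

theorem absRamificationIdx_pos : 0 < absRamificationIdx K := by
  refine Nat.pos_of_ne_zero fun h ↦ ?_
  have := absVal_two K
  rw [h, pow_zero] at this
  exact absVal_two_lt_one.ne this

instance hasFiniteQuotients_padicInt : Ring.HasFiniteQuotients ℤ_[2] where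
  finiteQuotient hI :=
    IsLocalRing.isOpen_iff_finite_quotient.1 (IsDiscreteValuationRing.isOpen_iff.2 hI)

instance finite_residue : Finite (Integers K ⧸ maxIdeal K) :=
  (Ring.HasFiniteQuotients.of_module_finite ℤ_[2] (Integers K)).finiteQuotient maxIdeal_ne_bot

end LocalField

section Squares

variable {K : Type*} [Field K] [Algebra ℚ_[2] K]

theorem exists_sq_eq_of_absVal_sub_lt {L : Type*} [Field L] [IsAlgClosed L] [Algebra ℚ_[2] L]
    [Algebra.IsAlgebraic ℚ_[2] L] {b c : L} (h : absVal L (b - c ^ 2) < absVal L 2 ^ 2) :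
    ∃ z : L, z ^ 2 = b ∧ absVal L (z - c) < absVal L 2 := by
  obtain ⟨y, rfl⟩ := IsAlgClosed.exists_pow_nat_eq b (n := 2) two_pos
  by_contra! hfar
  have hpos := hfar y rfl
  have hneg := hfar (-y) (neg_sq y)
  have hprod : absVal L (y ^ 2 - c ^ 2) = absVal L (y - c) * absVal L (-y - c) := by
    rw [← (absVal L).map_neg (-y - c), ← map_mul]
    ring_nf
  rw [hprod, sq] at h
  exact h.not_ge (mul_le_mul hpos hneg ((absVal L).nonneg _) ((absVal L).nonneg _))

-- Krasner's argument: a conjugate `-z` would be as close to `1` as `z` is, but `z` and `-z` both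
-- close to `1` makes `2` too small.
theorem mem_range_of_sq_mem_range_of_absVal_sub_one_lt {L : Type*} [Field L] [Algebra ℚ_[2] L]
    [Algebra.IsAlgebraic ℚ_[2] L] [Algebra K L] [IsScalarTower ℚ_[2] K L] [IsGalois K L] {z : L}
    (hz : z ^ 2 ∈ (algebraMap K L).range) (h : absVal L (z - 1) < absVal L 2) :
    z ∈ (algebraMap K L).range := by
  refine (InfiniteGalois.mem_bot_iff_fixed z).2 fun σ ↦ ?_
  obtain ⟨a, ha⟩ := hz
  have hσ : (σ z) ^ 2 = z ^ 2 := by rw [← map_pow, ← ha, σ.commutes]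
  refine (sq_eq_sq_iff_eq_or_eq_neg.1 hσ).resolve_right fun hneg ↦ h.not_ge ?_
  have hconj : absVal L (-z - 1) = absVal L (z - 1) := by
    rw [← absVal_algEquiv σ (z - 1), map_sub σ, map_one, hneg]
  calc absVal L 2 = absVal L (z - 1 + (-z - 1)) := by rw [← (absVal L).map_neg]; ring_nf
    _ ≤ max (absVal L (z - 1)) (absVal L (-z - 1)) := absVal_add_le _ _
    _ = absVal L (z - 1) := by rw [hconj, max_self]

theorem exists_sq_of_absVal_sub_one_lt [Algebra.IsAlgebraic ℚ_[2] K] {a : K}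
    (h : absVal K (a - 1) < absVal K 4) :
    ∃ s : K, a = s ^ 2 := by
  have := charZero_of_algebra_padic K
  have : Algebra.IsAlgebraic ℚ_[2] (AlgebraicClosure K) := Algebra.IsAlgebraic.trans _ K _
  have hnear : absVal (AlgebraicClosure K) (algebraMap K _ a - 1 ^ 2) <
      absVal (AlgebraicClosure K) 2 ^ 2 :=
    calc absVal (AlgebraicClosure K) (algebraMap K _ a - 1 ^ 2)
        = absVal (AlgebraicClosure K) (algebraMap K _ (a - 1)) := by
          rw [map_sub (algebraMap K _), map_one (algebraMap K _), one_pow]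
      _ = absVal K (a - 1) := absVal_algebraMap _
      _ < absVal K (2 ^ 2) := by rwa [show (2 : K) ^ 2 = 4 by norm_num]
      _ = absVal (AlgebraicClosure K) (algebraMap K _ 2) ^ 2 := by rw [absVal_algebraMap, map_pow]
      _ = absVal (AlgebraicClosure K) 2 ^ 2 := by rw [map_ofNat]
  obtain ⟨z, hz, hz1⟩ := exists_sq_eq_of_absVal_sub_lt hnear
  obtain ⟨s, rfl⟩ := mem_range_of_sq_mem_range_of_absVal_sub_one_lt (K := K) ⟨a, hz.symm⟩ hz1
  exact ⟨s, (algebraMap K (AlgebraicClosure K)).injective (by rw [map_pow, hz])⟩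

end Squares

section SquareClasses

variable {K : Type*} [Field K]

theorem mem_sup_square_iff {G : Type*} [CommGroup G] {H : Subgroup G} {a : G} :
    a ∈ H ⊔ Subgroup.square G ↔ ∃ s : G, a / s ^ 2 ∈ H := by
  rw [Subgroup.mem_sup]
  constructor
  · rintro ⟨y, hy, _, ⟨s, rfl⟩, rfl⟩
    exact ⟨s, by rwa [sq, mul_div_cancel_right]⟩
  · rintro ⟨s, hs⟩
    exact ⟨_, hs, s ^ 2, IsSquare.sq s, div_mul_cancel _ _⟩

theorem isSquare_units_iff {u : Kˣ} : IsSquare u ↔ IsSquare (u : K) := by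
  refine ⟨fun ⟨s, hs⟩ ↦ ⟨s, by rw [hs, Units.val_mul]⟩, fun ⟨s, hs⟩ ↦ ?_⟩
  have hs0 : s ≠ 0 := left_ne_zero_of_mul (hs ▸ u.ne_zero)
  exact ⟨Units.mk0 s hs0, Units.ext hs⟩

variable (K) in
/-- The group `Kˣ / Kˣ²`, whose nontrivial elements classify the quadratic extensions of `K` when
`2` is invertible. -/
abbrev SquareClass : Type _ := Kˣ ⧸ Subgroup.square Kˣ

end SquareClasses

section ArtinSchreier

/-- The additive map `x ↦ x ^ 2 + x` in characteristic two. -/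
def artinSchreier (k : Type*) [CommRing k] [CharP k 2] : k →+ k where
  toFun x := x ^ 2 + x
  map_zero' := by rw [sq, mul_zero, add_zero]
  map_add' x y := by rw [CharTwo.add_sq, add_add_add_comm]

theorem artinSchreier_apply {k : Type*} [CommRing k] [CharP k 2] (x : k) :
    artinSchreier k x = x ^ 2 + x := rfl

variable (k : Type*) [CommRing k] [IsDomain k] [CharP k 2]

theorem coe_ker_artinSchreier : ((artinSchreier k).ker : Set k) = {0, 1} := by
  ext x
  rw [SetLike.mem_coe, AddMonoidHom.mem_ker, artinSchreier_apply, Set.mem_insert_iff,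
    Set.mem_singleton_iff, sq, ← mul_add_one, mul_eq_zero, CharTwo.add_eq_zero]

theorem index_range_artinSchreier [Finite k] : (artinSchreier k).range.index = 2 := by
  have hker : Nat.card (artinSchreier k).ker = 2 := by
    rw [← SetLike.coe_sort_coe, coe_ker_artinSchreier, Nat.card_coe_set_eq,
      Set.ncard_pair zero_ne_one]
  have h : 2 * Nat.card (artinSchreier k).range =
      (artinSchreier k).range.index * Nat.card (artinSchreier k).range := by
    rw [← hker, AddSubgroup.index_mul_card, ← AddSubgroup.index_ker, AddSubgroup.card_mul_index]
  exact (mul_right_cancel₀ Nat.card_pos.ne' h).symm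

end ArtinSchreier

section SquaresNearOne

variable {K : Type*} [Field K] [Algebra ℚ_[2] K] [Algebra.IsAlgebraic ℚ_[2] K]

theorem absVal_div_sub_one {u s : K} (h : absVal K s = 1) :
    absVal K (u / s - 1) = absVal K (u - s) := by
  have hs : s ≠ 0 := (absVal K).pos_iff.1 (h ▸ one_pos)
  rw [div_sub_one hs, map_div₀, h, div_one]

theorem absVal_eq_one_of_sub_lt {u s : K} (hu : absVal K u = 1) (h : absVal K (u - s) < 1) :
    absVal K s = 1 := by
  have := absVal_add_of_lt (x := -(u - s)) (y := u) (by rwa [(absVal K).map_neg, hu])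
  rwa [neg_sub, sub_add_cancel, hu] at this

theorem absVal_sq_sub_one_of_lt {s : K} (h : absVal K 2 < absVal K (s - 1)) :
    absVal K (s ^ 2 - 1) = absVal K (s - 1) ^ 2 := by
  rw [show s ^ 2 - 1 = (s - 1) * (2 + (s - 1)) by ring, map_mul, absVal_add_of_lt h, sq]

theorem absVal_sq_sub_one_le {s : K} (h : absVal K (s - 1) ≤ absVal K 2) :
    absVal K (s ^ 2 - 1) ≤ absVal K 4 := by
  rw [show s ^ 2 - 1 = (s - 1) * (2 + (s - 1)) by ring, show (4 : K) = 2 * 2 by norm_num, map_mul,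
    map_mul]
  gcongr
  exact (absVal_add_le _ _).trans (max_le le_rfl h)

theorem absVal_sub_one_le_two {s : K} (h : absVal K (s ^ 2 - 1) ≤ absVal K 4) :
    absVal K (s - 1) ≤ absVal K 2 := by
  by_contra! hlt
  rw [absVal_sq_sub_one_of_lt hlt, show (4 : K) = 2 ^ 2 by norm_num, map_pow] at h
  exact h.not_gt (pow_lt_pow_left₀ hlt ((absVal K).nonneg _) two_ne_zero)

variable [Algebra ℤ_[2] K] [IsScalarTower ℤ_[2] ℚ_[2] K]

-- Substituting `s = 1 + 2 x` turns `u = s ^ 2` into the equation `(u - 1) / 4 = x ^ 2 + x`.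
theorem isSquare_iff_exists_absVal_sub_lt_one {u : K} (hu : absVal K (u - 1) ≤ absVal K 4) :
    IsSquare u ↔ ∃ x : Integers K, absVal K ((u - 1) / 4 - (x ^ 2 + x)) < 1 := by
  have h2 := two_ne_zero_of_algebra_padic K
  have h4 : (4 : K) ≠ 0 := by rw [show (4 : K) = 2 ^ 2 by norm_num]; exact pow_ne_zero 2 h2
  constructor
  · rintro ⟨s, rfl⟩
    rw [← sq] at hu ⊢
    refine ⟨⟨(s - 1) / 2, (mem_integers_iff_absVal _).2 ?_⟩, ?_⟩
    · rw [map_div₀]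
      exact div_le_one_of_le₀ (absVal_sub_one_le_two hu) ((absVal K).nonneg _)
    · have h0 : (s ^ 2 - 1) / 4 - (((s - 1) / 2) ^ 2 + (s - 1) / 2) = 0 := by field_simp; ring
      rw [h0, map_zero]
      exact one_pos
  · rintro ⟨x, hx⟩
    have hs : absVal K (1 + 2 * x) = 1 := by
      refine absVal_eq_one_of_sub_lt (map_one _) ?_
      rw [sub_add_cancel_left, (absVal K).map_neg, map_mul]
      exact mul_lt_one_of_nonneg_of_lt_one_left ((absVal K).nonneg _) absVal_two_lt_one
        (absVal_le_one_of_integers x)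
    have hclose : absVal K (u / (1 + 2 * x) ^ 2 - 1) < absVal K 4 := by
      rw [absVal_div_sub_one (by rw [map_pow, hs, one_pow]),
        show u - (1 + 2 * x) ^ 2 = 4 * ((u - 1) / 4 - (x ^ 2 + x)) by field_simp; ring, map_mul]
      exact mul_lt_of_lt_one_right ((absVal K).pos h4) hx
    obtain ⟨r, hr⟩ := exists_sq_of_absVal_sub_one_lt hclose
    have hs0 : (1 + 2 * x : K) ^ 2 ≠ 0 :=
      pow_ne_zero 2 ((absVal K).pos_iff.1 (hs ▸ one_pos))
    exact ⟨r * (1 + 2 * x), by rw [← sq, mul_pow, ← hr, div_mul_cancel₀ _ hs0]⟩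

end SquaresNearOne

section HigherUnits

variable (K : Type*) [Field K] [Algebra ℚ_[2] K] [FiniteDimensional ℚ_[2] K]
    [Algebra ℤ_[2] K] [IsScalarTower ℤ_[2] ℚ_[2] K]

/-- The group of units of `K` of absolute value `1` congruent to `1` modulo `𝔭 ^ n`; thus
`higherUnits K 0` is the full unit group of the valuation ring. -/
def higherUnits (n : ℕ) : Subgroup Kˣ where
  carrier := {u | absVal K u = 1 ∧ absVal K (u - 1 : K) ≤ rho K ^ n}
  one_mem' := by simp [(pow_pos (rho_pos K) n).le]
  mul_mem' := by
    rintro u v ⟨hu, hu'⟩ ⟨hv, hv'⟩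
    refine ⟨by simp [hu, hv], ?_⟩
    rw [Units.val_mul, show (u * v - 1 : K) = u * (v - 1) + (u - 1) by ring]
    refine (absVal_add_le _ _).trans (max_le ?_ hu')
    rwa [map_mul, hu, one_mul]
  inv_mem' := by
    rintro u ⟨hu, hu'⟩
    refine ⟨by simp [hu], ?_⟩
    have : ((u⁻¹ : Kˣ) : K) - 1 = -((u⁻¹ : Kˣ) * (u - 1)) := by simp [mul_sub]
    rw [this, (absVal K).map_neg, map_mul]
    simpa [hu] using hu'

variable {K}

theorem mem_higherUnits {n : ℕ} {u : Kˣ} :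
    u ∈ higherUnits K n ↔ absVal K u = 1 ∧ absVal K (u - 1 : K) ≤ rho K ^ n := Iff.rfl

theorem mem_higherUnits_zero {u : Kˣ} : u ∈ higherUnits K 0 ↔ absVal K u = 1 := by
  rw [mem_higherUnits, and_iff_left_of_imp]
  intro hu
  rw [pow_zero]
  exact (absVal_sub_le _ _).trans_eq (by rw [hu, map_one, max_self])

theorem higherUnits_anti {m n : ℕ} (h : m ≤ n) : higherUnits K n ≤ higherUnits K m :=
  fun _ hu ↦ ⟨hu.1, hu.2.trans (rho_pow_le_rho_pow h)⟩

theorem residue_mk_eq_mk_iff {x y : Integers K} :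
    Ideal.Quotient.mk (maxIdeal K) x = Ideal.Quotient.mk (maxIdeal K) y ↔
      absVal K (x - y : K) < 1 := by
  rw [Ideal.Quotient.eq, mem_maxIdeal_iff, Subalgebra.coe_sub]

instance charP_residue : CharP (Integers K ⧸ maxIdeal K) 2 := by
  refine CharTwo.of_one_ne_zero_of_two_eq_zero (fun h ↦ ?_) ?_
  · rw [← map_one (Ideal.Quotient.mk (maxIdeal K)), Ideal.Quotient.eq_zero_iff_mem] at h
    exact (Ideal.ne_top_iff_one _).1 (isMaximal_maxIdeal (F := K)).ne_top h
  · rw [← map_ofNat (Ideal.Quotient.mk (maxIdeal K)), Ideal.Quotient.eq_zero_iff_mem,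
      mem_maxIdeal_iff]
    exact absVal_two_lt_one

theorem one_lt_residueCard : 1 < residueCard K := by
  have : Nontrivial (Integers K ⧸ maxIdeal K) :=
    Ideal.Quotient.nontrivial_iff.2 (isMaximal_maxIdeal (F := K)).ne_top
  exact Finite.one_lt_card

theorem exists_absVal_sub_sq_lt_one (w : Integers K) :
    ∃ z : Integers K, absVal K (w - z ^ 2 : K) < 1 := by
  let : Field (Integers K ⧸ maxIdeal K) := Ideal.Quotient.field _
  obtain ⟨z, hz⟩ := (bijective_frobenius (Integers K ⧸ maxIdeal K) 2).2
    (Ideal.Quotient.mk (maxIdeal K) w)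
  obtain ⟨z, rfl⟩ := Ideal.Quotient.mk_surjective z
  rw [frobenius_def, ← map_pow] at hz
  exact ⟨z, by simpa using residue_mk_eq_mk_iff.1 hz.symm⟩

theorem exists_absVal_sub_sq_le {j : ℕ} (hj : j < absRamificationIdx K) {u : K}
    (hu : absVal K (u - 1) ≤ rho K ^ (2 * j)) :
    ∃ s : K, absVal K (u - s ^ 2) ≤ rho K ^ (2 * j + 1) := by
  set π := uniformizer K
  have hπ0 : π ^ (2 * j) ≠ 0 := pow_ne_zero _ uniformizer_ne_zero
  have hint : (u - 1) / π ^ (2 * j) ∈ Integers K := by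
    rw [mem_integers_iff_absVal, map_div₀, map_pow, absVal_uniformizer]
    exact div_le_one_of_le₀ hu (pow_pos (rho_pos K) _).le
  obtain ⟨z, hz⟩ := exists_absVal_sub_sq_lt_one ⟨_, hint⟩
  refine ⟨1 + π ^ j * z, ?_⟩
  have hsplit : u - (1 + π ^ j * z) ^ 2 =
      π ^ (2 * j) * ((u - 1) / π ^ (2 * j) - z ^ 2) - 2 * π ^ j * z := by
    rw [mul_sub, mul_div_cancel₀ _ hπ0]; ring
  rw [hsplit]
  refine (absVal_sub_le _ _).trans (max_le ?_ ?_)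
  · rw [map_mul, map_pow, absVal_uniformizer, pow_succ (rho K)]
    gcongr
    · exact (pow_pos (rho_pos K) _).le
    · exact absVal_lt_one_iff.1 hz
  · rw [map_mul, map_mul, map_pow, absVal_uniformizer, absVal_two, ← pow_add]
    exact (mul_le_of_le_one_right (pow_pos (rho_pos K) _).le (absVal_le_one_of_integers z)).trans
      (rho_pow_le_rho_pow (by omega))

theorem mem_sup_square_of_absVal_sub_sq_le {n : ℕ} (hn : n ≠ 0) {u : Kˣ} (hu : absVal K u = 1)
    {s : K} (h : absVal K (u - s ^ 2 : K) ≤ rho K ^ n) :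
    u ∈ higherUnits K n ⊔ Subgroup.square Kˣ := by
  have hs : absVal K (s ^ 2) = 1 := absVal_eq_one_of_sub_lt hu (h.trans_lt (rho_pow_lt_one hn))
  have hs0 : s ≠ 0 := pow_ne_zero_iff two_ne_zero |>.1 ((absVal K).pos_iff.1 (hs ▸ one_pos))
  refine mem_sup_square_iff.2 ⟨Units.mk0 s hs0, ?_⟩
  rw [mem_higherUnits, Units.val_div_eq_div_val, Units.val_pow_eq_pow_val, Units.val_mk0, map_div₀,
    hs, hu, div_one, absVal_div_sub_one hs]
  exact ⟨rfl, h⟩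

theorem higherUnits_even_le {j : ℕ} (hj : j < absRamificationIdx K) :
    higherUnits K (2 * j) ≤ higherUnits K (2 * j + 1) ⊔ Subgroup.square Kˣ := by
  rintro u ⟨hu, hu'⟩
  obtain ⟨s, hs⟩ := exists_absVal_sub_sq_le hj hu'
  exact mem_sup_square_of_absVal_sub_sq_le (by omega) hu hs

-- A square `s ^ 2` not close to `1` satisfies `v (s ^ 2 - 1) = 2 * v (s - 1)`, an even number.
theorem absVal_sq_sub_one_le_of_le {j : ℕ} (hj : j < absRamificationIdx K) {s : K}
    (h : absVal K (s ^ 2 - 1) ≤ rho K ^ (2 * j + 1)) :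
    absVal K (s ^ 2 - 1) ≤ rho K ^ (2 * j + 2) := by
  rcases le_or_gt (absVal K (s - 1)) (absVal K 2) with hs | hs
  · calc absVal K (s ^ 2 - 1) ≤ absVal K 4 := absVal_sq_sub_one_le hs
      _ = rho K ^ (2 * absRamificationIdx K) := absVal_four K
      _ ≤ rho K ^ (2 * j + 2) := rho_pow_le_rho_pow (by omega)
  · obtain ⟨n, hn⟩ := exists_absVal_eq ((absVal K).pos_iff.1 (absVal_two_pos.trans hs))
    rw [absVal_sq_sub_one_of_lt hs, hn, ← zpow_natCast, ← zpow_natCast, ← zpow_mul,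
      rho_zpow_le_zpow_iff] at h ⊢
    omega

theorem higherUnits_odd_inf {j : ℕ} (hj : j < absRamificationIdx K) :
    (higherUnits K (2 * j + 2) ⊔ Subgroup.square Kˣ) ⊓ higherUnits K (2 * j + 1) =
      higherUnits K (2 * j + 2) := by
  refine le_antisymm ?_ (le_inf le_sup_left (higherUnits_anti (by omega)))
  rintro u ⟨hu, hu1⟩
  obtain ⟨v, hv, w, hw, rfl⟩ := Subgroup.mem_sup.1 hu
  refine mul_mem hv ?_
  have hw1 : w ∈ higherUnits K (2 * j + 1) :=
    (Subgroup.mul_mem_cancel_left _ (higherUnits_anti (by omega) hv)).1 hu1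
  obtain ⟨s, hs⟩ := isSquare_units_iff.1 hw
  refine ⟨hw1.1, ?_⟩
  have hle := hw1.2
  rw [hs, ← sq] at hle ⊢
  exact absVal_sq_sub_one_le_of_le hj hle

/-- The homomorphism `u ↦ (u - 1) / t` from the units congruent to `1` modulo `𝔭 ^ n` to the residue
field, where `t` generates `𝔭 ^ n` and `n` is positive. -/
def unitResidue {n : ℕ} (hn : 0 < n) {t : K} (ht : absVal K t = rho K ^ n) :
    higherUnits K n →* Multiplicative (Integers K ⧸ maxIdeal K) where
  toFun u := Multiplicative.ofAdd (Ideal.Quotient.mk (maxIdeal K) ⟨((u : Kˣ) - 1 : K) / t,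
    (mem_integers_iff_absVal _).2 (by
      rw [map_div₀, ht]
      exact div_le_one_of_le₀ u.2.2 (pow_pos (rho_pos K) _).le)⟩)
  map_one' := by
    rw [ofAdd_eq_one, Ideal.Quotient.eq_zero_iff_mem, mem_maxIdeal_iff]
    simp
  map_mul' u v := by
    rw [← ofAdd_add, ← map_add]
    congr 1
    rw [residue_mk_eq_mk_iff]
    have hpos : 0 < rho K ^ n := pow_pos (rho_pos K) n
    have : (((u * v : higherUnits K n) : Kˣ) - 1 : K) / t -
        ((((u : Kˣ) - 1 : K) / t + ((v : Kˣ) - 1 : K) / t : K)) =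
        ((u : Kˣ) - 1 : K) * ((v : Kˣ) - 1 : K) / t := by
      push_cast; ring
    rw [Subalgebra.coe_add, this, map_div₀, map_mul, ht, div_lt_one hpos]
    calc absVal K ((u : Kˣ) - 1 : K) * absVal K ((v : Kˣ) - 1 : K)
        ≤ rho K ^ n * rho K ^ n := mul_le_mul u.2.2 v.2.2 ((absVal K).nonneg _) hpos.le
      _ < rho K ^ n := mul_lt_of_lt_one_left hpos (rho_pow_lt_one hn.ne')

theorem unitResidue_eq_iff {n : ℕ} (hn : 0 < n) {t : K} (ht : absVal K t = rho K ^ n)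
    (u : higherUnits K n) (x : Integers K) :
    unitResidue hn ht u = Multiplicative.ofAdd (Ideal.Quotient.mk (maxIdeal K) x) ↔
      absVal K (((u : Kˣ) - 1 : K) / t - x) < 1 := by
  rw [← residue_mk_eq_mk_iff (x := ⟨((u : Kˣ) - 1 : K) / t, _⟩)]
  exact Multiplicative.ofAdd.injective.eq_iff

theorem unitResidue_surjective {n : ℕ} (hn : 0 < n) {t : K} (ht : absVal K t = rho K ^ n) :
    Function.Surjective (unitResidue hn ht) := by
  intro x
  obtain ⟨x, rfl⟩ := Multiplicative.ofAdd.surjective x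
  obtain ⟨x, rfl⟩ := Ideal.Quotient.mk_surjective x
  have ht0 : 0 < absVal K t := ht ▸ pow_pos (rho_pos K) n
  have h1 : absVal K (t * x) ≤ rho K ^ n := by
    rw [map_mul, ht]
    exact mul_le_of_le_one_right (pow_pos (rho_pos K) _).le (absVal_le_one_of_integers x)
  have h2 : absVal K (1 + t * x) = 1 := by
    refine absVal_eq_one_of_sub_lt (map_one _) ?_
    rw [sub_add_cancel_left, (absVal K).map_neg]
    exact h1.trans_lt (rho_pow_lt_one hn.ne')
  refine ⟨⟨Units.mk0 (1 + t * x) (fun h ↦ by simp [h] at h2), h2, by simpa using h1⟩, ?_⟩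
  rw [unitResidue_eq_iff]
  simp [(absVal K).pos_iff.1 ht0]

theorem higherUnits_relIndex {n : ℕ} (hn : 0 < n) :
    (higherUnits K (n + 1)).relIndex (higherUnits K n) = residueCard K := by
  have ht : absVal K (uniformizer K ^ n) = rho K ^ n := by rw [map_pow, absVal_uniformizer]
  have hker : (higherUnits K (n + 1)).subgroupOf (higherUnits K n) = (unitResidue hn ht).ker := by
    ext u
    have h0 := unitResidue_eq_iff hn ht u 0
    rw [map_zero, ofAdd_zero, Subalgebra.coe_zero, sub_zero, map_div₀] at h0
    have h1 : absVal K ((u : Kˣ) - 1 : K) / absVal K (uniformizer K ^ n) < 1 ↔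
        absVal K ((u : Kˣ) - 1 : K) ≤ rho K ^ ((n : ℤ) + 1) := by
      rw [ht, div_lt_one (pow_pos (rho_pos K) n), ← zpow_natCast, absVal_lt_rho_zpow_iff]
    rw [Subgroup.mem_subgroupOf, MonoidHom.mem_ker, h0, h1, mem_higherUnits]
    exact ⟨fun h ↦ by exact_mod_cast h.2, fun h ↦ ⟨u.2.1, by exact_mod_cast h⟩⟩
  rw [Subgroup.relIndex, hker, Subgroup.index_ker,
    MonoidHom.range_eq_top.2 (unitResidue_surjective hn ht), Subgroup.card_top]
  rfl

theorem unitResidue_mem_range_artinSchreier_iff {n : ℕ} (hn : 0 < n) {t : K}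
    (ht : absVal K t = rho K ^ n) (u : higherUnits K n) :
    unitResidue hn ht u ∈
        AddSubgroup.toSubgroup (artinSchreier (Integers K ⧸ maxIdeal K)).range ↔
      ∃ x : Integers K, absVal K (((u : Kˣ) - 1 : K) / t - (x ^ 2 + x)) < 1 := by
  have hx (x : Integers K) : absVal K (((u : Kˣ) - 1 : K) / t - (x ^ 2 + x)) < 1 ↔
      Multiplicative.ofAdd (artinSchreier _ (Ideal.Quotient.mk (maxIdeal K) x)) =
        unitResidue hn ht u := by
    rw [artinSchreier_apply, ← map_pow, ← map_add, eq_comm, unitResidue_eq_iff,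
      Subalgebra.coe_add, Subalgebra.coe_pow]
  simp only [hx]
  exact Ideal.Quotient.mk_surjective.exists

theorem square_relIndex_higherUnits :
    (Subgroup.square Kˣ).relIndex (higherUnits K (2 * absRamificationIdx K)) = 2 := by
  let : Field (Integers K ⧸ maxIdeal K) := Ideal.Quotient.field _
  have hn : 0 < 2 * absRamificationIdx K := mul_pos two_pos (absRamificationIdx_pos K)
  have hcomap : (Subgroup.square Kˣ).subgroupOf (higherUnits K (2 * absRamificationIdx K)) =
      (AddSubgroup.toSubgroup (artinSchreier (Integers K ⧸ maxIdeal K)).range).comap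
        (unitResidue hn (absVal_four K)) := by
    ext u
    rw [Subgroup.mem_subgroupOf, Subgroup.mem_square, isSquare_units_iff,
      isSquare_iff_exists_absVal_sub_lt_one (u.2.2.trans_eq (absVal_four K).symm),
      Subgroup.mem_comap, unitResidue_mem_range_artinSchreier_iff]
  rw [Subgroup.relIndex, hcomap, Subgroup.index_comap_of_surjective _ (unitResidue_surjective _ _)]
  exact index_range_artinSchreier (Integers K ⧸ maxIdeal K)

theorem mem_sup_square_zero_iff {a : Kˣ} :
    a ∈ higherUnits K 0 ⊔ Subgroup.square Kˣ ↔ ∃ n : ℤ, absVal K a = rho K ^ (2 * n) := by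
  simp only [mem_sup_square_iff, mem_higherUnits_zero, Units.val_div_eq_div_val,
    Units.val_pow_eq_pow_val, map_div₀, map_pow]
  constructor
  · rintro ⟨s, hs⟩
    obtain ⟨n, hn⟩ := exists_absVal_eq s.ne_zero
    refine ⟨n, ?_⟩
    rw [eq_of_div_eq_one hs, hn, ← zpow_natCast, ← zpow_mul, mul_comm, Nat.cast_ofNat]
  · rintro ⟨n, hn⟩
    refine ⟨Units.mk0 (uniformizer K) uniformizer_ne_zero ^ n, ?_⟩
    rw [hn, Units.val_zpow_eq_zpow_val, map_zpow₀, Units.val_mk0, absVal_uniformizer,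
      ← zpow_natCast, ← zpow_mul, mul_comm, Nat.cast_ofNat,
      div_self (zpow_ne_zero _ (rho_pos K).ne')]

theorem index_sup_square_zero : (higherUnits K 0 ⊔ Subgroup.square Kˣ).index = 2 := by
  rw [Subgroup.index_eq_two_iff]
  refine ⟨Units.mk0 (uniformizer K) uniformizer_ne_zero, fun b ↦ ?_⟩
  obtain ⟨m, hm⟩ := exists_absVal_eq b.ne_zero
  rw [mem_sup_square_zero_iff, mem_sup_square_zero_iff, Units.val_mul, map_mul, hm, Units.val_mk0,
    absVal_uniformizer, ← zpow_add_one₀ (rho_pos K).ne']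
  simp only [rho_zpow_inj]
  rcases Int.even_or_odd' m with ⟨k, rfl | rfl⟩
  · exact Or.inr ⟨⟨k, rfl⟩, by rintro ⟨n, hn⟩; omega⟩
  · exact Or.inl ⟨⟨k + 1, by ring⟩, by rintro ⟨n, hn⟩; omega⟩

theorem sup_square_even_eq {j : ℕ} (hj : j < absRamificationIdx K) :
    higherUnits K (2 * j) ⊔ Subgroup.square Kˣ = higherUnits K (2 * j + 1) ⊔ Subgroup.square Kˣ :=
  le_antisymm (sup_le (higherUnits_even_le hj) le_sup_right)
    (sup_le_sup_right (higherUnits_anti (by omega)) _)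

theorem sup_square_relIndex {j : ℕ} (hj : j < absRamificationIdx K) :
    (higherUnits K (2 * j + 2) ⊔ Subgroup.square Kˣ).relIndex
      (higherUnits K (2 * j) ⊔ Subgroup.square Kˣ) = residueCard K := by
  have h : higherUnits K (2 * j + 1) ⊔ Subgroup.square Kˣ =
      higherUnits K (2 * j + 1) ⊔ (higherUnits K (2 * j + 2) ⊔ Subgroup.square Kˣ) := by
    rw [← sup_assoc, sup_eq_left.2 (higherUnits_anti (by omega))]
  rw [sup_square_even_eq hj, h, Subgroup.relIndex_sup_right, ← Subgroup.inf_relIndex_right,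
    higherUnits_odd_inf hj, higherUnits_relIndex (by omega)]

variable (K) in
/-- The square classes `a` such that `K(√a)` has discriminant exponent at most `2 m`. -/
def classFiltration (m : ℕ) : Subgroup (SquareClass K) :=
  (higherUnits K (2 * (absRamificationIdx K - m)) ⊔ Subgroup.square Kˣ).map
    (QuotientGroup.mk' (Subgroup.square Kˣ))

theorem mk_mem_classFiltration {m : ℕ} {a : Kˣ} :
    (a : SquareClass K) ∈ classFiltration K m ↔
      a ∈ higherUnits K (2 * (absRamificationIdx K - m)) ⊔ Subgroup.square Kˣ := by
  have h := Subgroup.comap_map_eq (QuotientGroup.mk' (Subgroup.square Kˣ))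
    (higherUnits K (2 * (absRamificationIdx K - m)) ⊔ Subgroup.square Kˣ)
  rw [QuotientGroup.ker_mk', sup_assoc, sup_idem] at h
  rw [← h, Subgroup.mem_comap]
  rfl

theorem classFiltration_mono {m n : ℕ} (h : m ≤ n) :
    classFiltration K m ≤ classFiltration K n :=
  Subgroup.map_mono (sup_le_sup_right (higherUnits_anti (by omega)) _)

theorem card_classFiltration_eq (m : ℕ) :
    Nat.card (classFiltration K m) = (Subgroup.square Kˣ).relIndex
      (higherUnits K (2 * (absRamificationIdx K - m)) ⊔ Subgroup.square Kˣ) := by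
  rw [classFiltration, ← Subgroup.relIndex_ker, QuotientGroup.ker_mk']

theorem card_classFiltration {m : ℕ} (hm : m ≤ absRamificationIdx K) :
    Nat.card (classFiltration K m) = 2 * residueCard K ^ m := by
  induction m with
  | zero =>
    rw [card_classFiltration_eq, Subgroup.relIndex_sup_right, Nat.sub_zero,
      square_relIndex_higherUnits, pow_zero, mul_one]
  | succ m ih =>
    have ih := ih (by omega)
    rw [card_classFiltration_eq] at ih ⊢
    have h := sup_square_relIndex (K := K) (j := absRamificationIdx K - (m + 1)) (by omega)
    rw [show 2 * (absRamificationIdx K - (m + 1)) + 2 = 2 * (absRamificationIdx K - m) by omega]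
      at h
    rw [← Subgroup.relIndex_mul_relIndex _ _ _ le_sup_right
      (sup_le_sup_right (higherUnits_anti (K := K)
        (show 2 * (absRamificationIdx K - (m + 1)) ≤ 2 * (absRamificationIdx K - m) by omega)) _),
      ih, h, pow_succ, mul_assoc]

theorem card_squareClass :
    Nat.card (SquareClass K) = 4 * residueCard K ^ absRamificationIdx K := by
  have h := card_classFiltration (K := K) le_rfl
  rw [card_classFiltration_eq, Nat.sub_self, mul_zero] at h
  rw [← Subgroup.index_eq_card, ← Subgroup.relIndex_mul_index
    (le_sup_right : Subgroup.square Kˣ ≤ higherUnits K 0 ⊔ Subgroup.square Kˣ), h,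
    index_sup_square_zero]
  ring

instance finite_squareClass : Finite (SquareClass K) := by
  refine Nat.finite_of_card_ne_zero ?_
  rw [card_squareClass]
  exact (mul_pos four_pos (pow_pos (one_pos.trans one_lt_residueCard) _)).ne'

end HigherUnits

section SubgroupSums

variable {G R : Type*} [Group G] [Fintype G] [CommRing R]

open Classical in
/-- The sum of the values of `w` on a subgroup. -/
def subgroupSum (w : G → R) (H : Subgroup G) : R := ∑ a with a ∈ H, w a

open Classical in
/-- The sum of `w a * w b * w c` over the triples in a subgroup with `a * b = c`. -/
def subgroupTripleSum (w : G → R) (H : Subgroup G) : R :=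
  ∑ a with a ∈ H, ∑ b with b ∈ H, w a * w b * w (a * b)

open Classical in
theorem card_filter_mem (H : Subgroup G) : (Finset.univ.filter (· ∈ H)).card = Nat.card H := by
  rw [← Fintype.card_subtype, Nat.card_eq_fintype_card]

open Classical in
theorem sum_filter_mem_mul_left {H : Subgroup G} {a : G} (ha : a ∈ H) (w : G → R) :
    ∑ b with b ∈ H, w (a * b) = subgroupSum w H := by
  refine Finset.sum_equiv (Equiv.mulLeft a) (fun b ↦ ?_) (fun b _ ↦ rfl)
  simp [H.mul_mem_cancel_left ha]

open Classical in
theorem sum_filter_mem_mul_right {H : Subgroup G} {b : G} (hb : b ∈ H) (w : G → R) :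
    ∑ a with a ∈ H, w (a * b) = subgroupSum w H := by
  refine Finset.sum_equiv (Equiv.mulRight b) (fun a ↦ ?_) (fun a _ ↦ rfl)
  simp [H.mul_mem_cancel_right hb]

theorem subgroupSum_const_add (c : R) (w : G → R) (H : Subgroup G) :
    subgroupSum (fun a ↦ c + w a) H = Nat.card H * c + subgroupSum w H := by
  rw [subgroupSum, Finset.sum_add_distrib, Finset.sum_const, card_filter_mem, nsmul_eq_mul,
    subgroupSum]

theorem subgroupTripleSum_const_add (c : R) (w : G → R) (H : Subgroup G) :
    subgroupTripleSum (fun a ↦ c + w a) H =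
      Nat.card H ^ 2 * c ^ 3 + 3 * Nat.card H * c ^ 2 * subgroupSum w H +
        3 * c * subgroupSum w H ^ 2 + subgroupTripleSum w H := by
  classical
  have hinner : ∀ a ∈ Finset.univ.filter (· ∈ H),
      ∑ b with b ∈ H, (c + w a) * (c + w b) * (c + w (a * b)) =
        (Nat.card H * c ^ 3 + 2 * c ^ 2 * subgroupSum w H) +
          (Nat.card H * c ^ 2 + 2 * c * subgroupSum w H) * w a +
            c * ∑ b with b ∈ H, w b * w (a * b) + ∑ b with b ∈ H, w a * w b * w (a * b) := by
    intro a ha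
    calc ∑ b with b ∈ H, (c + w a) * (c + w b) * (c + w (a * b))
        = ∑ b with b ∈ H, ((c + w a) * c ^ 2 + (c + w a) * c * w b + (c + w a) * c * w (a * b) +
            c * (w b * w (a * b)) + w a * w b * w (a * b)) :=
          Finset.sum_congr rfl fun b _ ↦ by ring
      _ = _ := by
          simp only [Finset.sum_add_distrib, ← Finset.mul_sum, Finset.sum_const, card_filter_mem,
            nsmul_eq_mul, sum_filter_mem_mul_left (Finset.mem_filter.1 ha).2]
          rw [← subgroupSum]
          ring
  have hcross : ∑ a with a ∈ H, ∑ b with b ∈ H, w b * w (a * b) = subgroupSum w H ^ 2 := by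
    rw [Finset.sum_comm, sq, subgroupSum, Finset.sum_mul]
    refine Finset.sum_congr rfl fun b hb ↦ ?_
    rw [← Finset.mul_sum, sum_filter_mem_mul_right (Finset.mem_filter.1 hb).2, subgroupSum]
  rw [subgroupTripleSum, Finset.sum_congr rfl hinner]
  simp only [Finset.sum_add_distrib, ← Finset.mul_sum, Finset.sum_const, card_filter_mem,
    nsmul_eq_mul, hcross]
  rw [← subgroupSum, ← subgroupTripleSum]
  ring

variable {A B : Subgroup G} {w : G → R}

theorem subgroupSum_eq_of_le (h : A ≤ B) (hw : ∀ a ∈ B, a ∉ A → w a = 0) :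
    subgroupSum w B = subgroupSum w A := by
  classical
  refine (Finset.sum_subset (Finset.monotone_filter_right _ fun _ _ ha ↦ h ha)
    fun a ha ha' ↦ hw a ?_ ?_).symm
  · exact (Finset.mem_filter.1 ha).2
  · simpa using ha'

theorem subgroupTripleSum_eq_of_le (h : A ≤ B) (hw : ∀ a ∈ B, a ∉ A → w a = 0) :
    subgroupTripleSum w B = subgroupTripleSum w A := by
  classical
  have hsub : Finset.univ.filter (· ∈ A) ⊆ Finset.univ.filter (· ∈ B) :=
    Finset.monotone_filter_right _ fun _ _ ha ↦ h ha
  have hzero : ∀ a ∈ Finset.univ.filter (· ∈ B), a ∉ Finset.univ.filter (· ∈ A) → w a = 0 := by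
    simpa using hw
  rw [subgroupTripleSum, ← Finset.sum_subset hsub fun a ha ha' ↦
    Finset.sum_eq_zero fun b _ ↦ by rw [hzero a ha ha', zero_mul, zero_mul]]
  exact Finset.sum_congr rfl fun a _ ↦ (Finset.sum_subset hsub fun b hb hb' ↦ by
    rw [hzero b hb hb', mul_zero, zero_mul]).symm

theorem subgroupSum_eq_add_of_le (h : A ≤ B) {c : R} (hw : ∀ a ∈ B, a ∉ A → w a = c) :
    subgroupSum w B = subgroupSum w A + (Nat.card B - Nat.card A) * c := by
  obtain ⟨d, rfl⟩ : ∃ d : G → R, w = fun a ↦ c + d a := ⟨fun a ↦ w a - c, by simp⟩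
  have hd : ∀ a ∈ B, a ∉ A → d a = 0 := fun a ha ha' ↦ add_eq_left.1 (hw a ha ha')
  rw [subgroupSum_const_add, subgroupSum_const_add, subgroupSum_eq_of_le h hd]
  ring

theorem subgroupTripleSum_eq_add_of_le (h : A ≤ B) {c : R} (hw : ∀ a ∈ B, a ∉ A → w a = c) :
    subgroupTripleSum w B =
      subgroupTripleSum w A + 3 * (Nat.card B - Nat.card A) * c ^ 2 * subgroupSum w A +
        (Nat.card B - Nat.card A) * (Nat.card B - 2 * Nat.card A) * c ^ 3 := by
  obtain ⟨d, rfl⟩ : ∃ d : G → R, w = fun a ↦ c + d a := ⟨fun a ↦ w a - c, by simp⟩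
  have hd : ∀ a ∈ B, a ∉ A → d a = 0 := fun a ha ha' ↦ add_eq_left.1 (hw a ha ha')
  rw [subgroupTripleSum_const_add, subgroupTripleSum_const_add, subgroupSum_const_add,
    subgroupSum_eq_of_le h hd, subgroupTripleSum_eq_of_le h hd]
  ring

end SubgroupSums

section Weights

variable (K : Type*) [Field K] [Algebra ℚ_[2] K] [FiniteDimensional ℚ_[2] K]
    [Algebra ℤ_[2] K] [IsScalarTower ℤ_[2] ℚ_[2] K]

open Classical in
/-- The discriminant exponent of the extension `K(√a)` of `K` attached to a square class `a`. -/
def discrExponent (a : SquareClass K) : ℕ :=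
  if a ∈ classFiltration K (absRamificationIdx K) then 2 * sInf {m | a ∈ classFiltration K m}
  else 2 * absRamificationIdx K + 1

open Classical in
/-- The factor `q ^ (-d)` contributed to the mass by a square class with discriminant exponent `d`,
replaced by zero for the classes with `K(√a)` unramified over `K`. -/
def ramifiedWeight (a : SquareClass K) : ℝ :=
  if a ∈ classFiltration K 0 then 0 else ((residueCard K : ℝ) ^ discrExponent K a)⁻¹

variable {K}

theorem discrExponent_of_mem {m : ℕ} (hm : m + 1 ≤ absRamificationIdx K) {a : SquareClass K}
    (ha : a ∈ classFiltration K (m + 1)) (ha' : a ∉ classFiltration K m) :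
    discrExponent K a = 2 * (m + 1) := by
  rw [discrExponent, if_pos (classFiltration_mono hm ha)]
  congr 1
  refine le_antisymm (Nat.sInf_le ha) (le_csInf ⟨_, ha⟩ fun n hn ↦ ?_)
  by_contra! h
  exact ha' (classFiltration_mono (by omega) hn)

theorem discrExponent_of_notMem {a : SquareClass K}
    (ha : a ∉ classFiltration K (absRamificationIdx K)) :
    discrExponent K a = 2 * absRamificationIdx K + 1 := if_neg ha

theorem ramifiedWeight_of_notMem {a : SquareClass K} (ha : a ∉ classFiltration K 0) :
    ramifiedWeight K a = ((residueCard K : ℝ) ^ discrExponent K a)⁻¹ := if_neg ha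

theorem ramifiedWeight_of_mem {a : SquareClass K} (ha : a ∈ classFiltration K 0) :
    ramifiedWeight K a = 0 :=
  if_pos ha

theorem ramifiedWeight_of_mem_succ {m : ℕ} (hm : m + 1 ≤ absRamificationIdx K) {a : SquareClass K}
    (ha : a ∈ classFiltration K (m + 1)) (ha' : a ∉ classFiltration K m) :
    ramifiedWeight K a = ((residueCard K : ℝ) ^ (2 * (m + 1)))⁻¹ := by
  rw [ramifiedWeight_of_notMem fun h ↦ ha' (classFiltration_mono m.zero_le h),
    discrExponent_of_mem hm ha ha']

theorem exists_mem_classFiltration_succ_notMem {a : SquareClass K}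
    (ha : a ∈ classFiltration K (absRamificationIdx K)) (h0 : a ∉ classFiltration K 0) :
    ∃ m, m + 1 ≤ absRamificationIdx K ∧
      a ∈ classFiltration K (m + 1) ∧ a ∉ classFiltration K m := by
  classical
  have hex : ∃ n, a ∈ classFiltration K n := ⟨_, ha⟩
  obtain ⟨m, hm⟩ : ∃ m, Nat.find hex = m + 1 :=
    Nat.exists_eq_add_one_of_ne_zero fun h ↦ h0 (h ▸ Nat.find_spec hex)
  exact ⟨m, hm ▸ Nat.find_min' hex ha, hm ▸ Nat.find_spec hex, Nat.find_min hex (by omega)⟩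

instance fintype_squareClass : Fintype (SquareClass K) := Fintype.ofFinite _

theorem classFiltration_le_succ (m : ℕ) : classFiltration K m ≤ classFiltration K (m + 1) :=
  classFiltration_mono m.le_succ

theorem one_lt_residueCard_cast : 1 < (residueCard K : ℝ) :=
  Nat.one_lt_cast.2 one_lt_residueCard

theorem residueCard_cast_ne_zero : (residueCard K : ℝ) ≠ 0 :=
  (one_pos.trans one_lt_residueCard_cast).ne'

theorem residueCard_pow_sub_one_ne_zero {n : ℕ} (hn : n ≠ 0) : (residueCard K : ℝ) ^ n - 1 ≠ 0 :=
  (sub_pos.2 (one_lt_pow₀ one_lt_residueCard_cast hn)).ne'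

theorem subgroupSum_ramifiedWeight {m : ℕ} (hm : m ≤ absRamificationIdx K) :
    subgroupSum (ramifiedWeight K) (classFiltration K m) =
      2 * (1 - ((residueCard K : ℝ) ^ m)⁻¹) * (residueCard K : ℝ)⁻¹ := by
  classical
  have hq := residueCard_cast_ne_zero (K := K)
  induction m with
  | zero =>
    rw [pow_zero, inv_one, sub_self, mul_zero, zero_mul, subgroupSum]
    exact Finset.sum_eq_zero fun a ha ↦ ramifiedWeight_of_mem (Finset.mem_filter.1 ha).2
  | succ m ih =>
    rw [subgroupSum_eq_add_of_le (classFiltration_le_succ m)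
        (fun _ ↦ ramifiedWeight_of_mem_succ hm),
      ih (by omega), card_classFiltration hm, card_classFiltration (by omega)]
    push_cast
    field_simp
    ring

theorem subgroupTripleSum_ramifiedWeight {m : ℕ} (hm : m ≤ absRamificationIdx K) {q : ℝ}
    (hq : q = residueCard K) :
    subgroupTripleSum (ramifiedWeight K) (classFiltration K m) =
      12 * (q - 1) / q ^ 2 * ((1 - (q ^ (3 * m))⁻¹) / (q ^ 3 - 1)) -
        4 * (q - 1) * (2 * q + 2) / q ^ 2 * ((1 - (q ^ (4 * m))⁻¹) / (q ^ 4 - 1)) := by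
  classical
  have hq0 : q ≠ 0 := hq ▸ residueCard_cast_ne_zero
  have hq3 : q ^ 3 - 1 ≠ 0 := hq ▸ residueCard_pow_sub_one_ne_zero three_ne_zero
  have hq4 : q ^ 4 - 1 ≠ 0 := hq ▸ residueCard_pow_sub_one_ne_zero four_ne_zero
  induction m with
  | zero =>
    simp only [mul_zero, pow_zero, inv_one, sub_self, zero_div]
    refine Finset.sum_eq_zero fun a ha ↦ Finset.sum_eq_zero fun b _ ↦ ?_
    rw [ramifiedWeight_of_mem (Finset.mem_filter.1 ha).2, zero_mul, zero_mul]
  | succ m ih =>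
    rw [subgroupTripleSum_eq_add_of_le (classFiltration_le_succ m)
        (fun _ ↦ ramifiedWeight_of_mem_succ hm),
      ih (by omega), subgroupSum_ramifiedWeight (by omega), card_classFiltration hm,
      card_classFiltration (by omega)]
    push_cast
    rw [← hq]
    field_simp
    ring

theorem subgroupTripleSum_ramifiedWeight_top {q : ℝ} (hq : q = residueCard K) {e : ℤ}
    (he : e = absRamificationIdx K) :
    subgroupTripleSum (ramifiedWeight K) ⊤ =
      24 * ((q - 1) / 6 *
        (q ^ (-4 * e - 3) * ((q ^ (4 * e) - 1) / (q ^ 4 - 1)) * (3 * q ^ 3 + q ^ 2 + q + 3) -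
          3 * q ^ (-3 * e - 3) * ((q ^ (3 * e) - 1) / (q ^ 3 - 1)) * (q ^ 2 + 1))) := by
  have hq0 : q ≠ 0 := hq ▸ residueCard_cast_ne_zero
  have hq3 : q ^ 3 - 1 ≠ 0 := hq ▸ residueCard_pow_sub_one_ne_zero three_ne_zero
  have hq4 : q ^ 4 - 1 ≠ 0 := hq ▸ residueCard_pow_sub_one_ne_zero four_ne_zero
  have hweight : ∀ a ∈ (⊤ : Subgroup (SquareClass K)),
      a ∉ classFiltration K (absRamificationIdx K) →
        ramifiedWeight K a = (q ^ (2 * absRamificationIdx K + 1))⁻¹ := by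
    intro a _ ha
    rw [ramifiedWeight_of_notMem fun h ↦ ha (classFiltration_mono (Nat.zero_le _) h),
      discrExponent_of_notMem ha, hq]
  have hneg4 : -4 * e - 3 = -((4 * absRamificationIdx K + 3 : ℕ) : ℤ) := by rw [he]; push_cast; ring
  have hneg3 : -3 * e - 3 = -((3 * absRamificationIdx K + 3 : ℕ) : ℤ) := by rw [he]; push_cast; ring
  have hpos4 : 4 * e = ((4 * absRamificationIdx K : ℕ) : ℤ) := by rw [he]; push_cast; ring
  have hpos3 : 3 * e = ((3 * absRamificationIdx K : ℕ) : ℤ) := by rw [he]; push_cast; ring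
  rw [subgroupTripleSum_eq_add_of_le le_top hweight, subgroupTripleSum_ramifiedWeight le_rfl hq,
    subgroupSum_ramifiedWeight le_rfl, card_classFiltration le_rfl, Subgroup.card_top,
    card_squareClass, hneg4, hneg3, hpos4, hpos3]
  simp only [zpow_neg, zpow_natCast]
  push_cast
  rw [← hq]
  field_simp
  ring

end Weights

section Biquadratic

/-- `L = K(x, y)` is biquadratic, where `x` and `y` are square roots of elements of `K`. -/
structure IsBiquadratic (K : Type*) {L : Type*} [Field K] [Field L] [Algebra K L] (x y : L) :
    Prop where
  sq_left : x ^ 2 ∈ (algebraMap K L).range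
  sq_right : y ^ 2 ∈ (algebraMap K L).range
  left_notMem : x ∉ (algebraMap K L).range
  right_notMem : y ∉ (algebraMap K L).range
  mul_notMem : x * y ∉ (algebraMap K L).range
  adjoin_eq_top : IntermediateField.adjoin K {x, y} = ⊤

variable {K L : Type*} [Field K] [Field L] [Algebra K L]

theorem apply_eq_or_neg_of_sq_mem {z : L} (hz : z ^ 2 ∈ (algebraMap K L).range) (σ : Gal(L/K)) :
    σ z = z ∨ σ z = -z := by
  obtain ⟨c, hc⟩ := hz
  apply sq_eq_sq_iff_eq_or_eq_neg.1
  rw [← map_pow, ← hc, σ.commutes]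

theorem mem_range_of_forall_fixed [IsGalois K L] [FiniteDimensional K L] {z : L}
    (h : ∀ σ : Gal(L/K), σ z = z) : z ∈ (algebraMap K L).range :=
  (IsGalois.mem_range_algebraMap_iff_fixed z).2 h

theorem mem_range_of_apply_eq [IsGalois K L] [FiniteDimensional K L] {s t : Gal(L/K)}
    (hall : ∀ σ, σ = 1 ∨ σ = s ∨ σ = t ∨ σ = s * t) {z : L} (hs : s z = z) (ht : t z = z) :
    z ∈ (algebraMap K L).range :=
  mem_range_of_forall_fixed fun σ ↦ by
    rcases hall σ with rfl | rfl | rfl | rfl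
    · rfl
    · exact hs
    · exact ht
    · rw [AlgEquiv.mul_apply, ht, hs]

theorem apply_eq_of_mem_range {z : L} (h : z ∈ (algebraMap K L).range) (σ : Gal(L/K)) :
    σ z = z := by
  obtain ⟨c, rfl⟩ := h
  exact σ.commutes c

theorem exists_apply_eq_neg [IsGalois K L] [FiniteDimensional K L] {z : L}
    (hz : z ^ 2 ∈ (algebraMap K L).range) (hz' : z ∉ (algebraMap K L).range) :
    ∃ σ : Gal(L/K), σ z = -z := by
  by_contra! h
  exact hz' (mem_range_of_forall_fixed fun σ ↦
    (apply_eq_or_neg_of_sq_mem hz σ).resolve_right (h σ))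

namespace IsBiquadratic

variable {x y : L} (h : IsBiquadratic K x y)

include h

theorem symm : IsBiquadratic K y x :=
  ⟨h.sq_right, h.sq_left, h.right_notMem, h.left_notMem, mul_comm x y ▸ h.mul_notMem,
    Set.pair_comm x y ▸ h.adjoin_eq_top⟩

theorem left_ne_zero : x ≠ 0 := fun h0 ↦ h.left_notMem (h0 ▸ zero_mem _)

theorem right_ne_zero : y ≠ 0 := h.symm.left_ne_zero

theorem ext_of_apply_eq {σ τ : Gal(L/K)} (hx : σ x = τ x) (hy : σ y = τ y) : σ = τ := by
  have : (σ : L →ₐ[K] L) = τ := by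
    refine AlgHom.ext fun z ↦ ?_
    have hz : z ∈ IntermediateField.adjoin K {x, y} := h.adjoin_eq_top ▸ IntermediateField.mem_top
    induction hz using IntermediateField.adjoin_induction with
    | mem z hz =>
      rcases hz with rfl | rfl
      · exact hx
      · exact hy
    | algebraMap c => simp
    | add z w _ _ hz hw => rw [map_add, map_add, hz, hw]
    | mul z w _ _ hz hw => rw [map_mul, map_mul, hz, hw]
    | inv z _ hz => rw [map_inv₀, map_inv₀, hz]
  exact AlgEquiv.ext fun z ↦ DFunLike.congr_fun this z

variable [IsGalois K L] [FiniteDimensional K L]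

theorem exists_neg_fix : ∃ σ : Gal(L/K), σ x = -x ∧ σ y = y := by
  obtain ⟨σ, hσ⟩ := exists_apply_eq_neg h.sq_left h.left_notMem
  rcases apply_eq_or_neg_of_sq_mem h.sq_right σ with hy | hy
  · exact ⟨σ, hσ, hy⟩
  obtain ⟨τ, hτ⟩ := exists_apply_eq_neg (z := x * y)
    (by rw [mul_pow]; exact mul_mem h.sq_left h.sq_right) h.mul_notMem
  rw [map_mul] at hτ
  rcases apply_eq_or_neg_of_sq_mem h.sq_left τ with hx' | hx'
  · rw [hx', ← mul_neg] at hτ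
    have hy' := mul_left_cancel₀ h.left_ne_zero hτ
    exact ⟨σ * τ, by rw [AlgEquiv.mul_apply, hx', hσ],
      by rw [AlgEquiv.mul_apply, hy', map_neg, hy, neg_neg]⟩
  · rw [hx', neg_mul, neg_inj] at hτ
    exact ⟨τ, hx', mul_left_cancel₀ h.left_ne_zero hτ⟩

theorem exists_fix_neg : ∃ σ : Gal(L/K), σ x = x ∧ σ y = -y := by
  obtain ⟨σ, h1, h2⟩ := h.symm.exists_neg_fix
  exact ⟨σ, h2, h1⟩

theorem exists_generators [CharZero K] : ∃ s t : Gal(L/K), (s x = x ∧ s y = -y) ∧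
    (t x = -x ∧ t y = y) ∧ (∀ σ, σ = 1 ∨ σ = s ∨ σ = t ∨ σ = s * t) ∧
    s ≠ 1 ∧ t ≠ 1 ∧ s ≠ t := by
  have : CharZero L := charZero_of_injective_algebraMap (algebraMap K L).injective
  obtain ⟨s, hs, hs'⟩ := h.exists_fix_neg
  obtain ⟨t, ht, ht'⟩ := h.exists_neg_fix
  have hx : -x ≠ x := neg_ne_self.2 h.left_ne_zero
  have hy : -y ≠ y := neg_ne_self.2 h.right_ne_zero
  refine ⟨s, t, ⟨hs, hs'⟩, ⟨ht, ht'⟩, fun σ ↦ ?_, ?_, ?_, ?_⟩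
  · rcases apply_eq_or_neg_of_sq_mem h.sq_left σ with h1 | h1 <;>
    rcases apply_eq_or_neg_of_sq_mem h.sq_right σ with h2 | h2
    · exact Or.inl (h.ext_of_apply_eq h1 h2)
    · exact Or.inr (Or.inl (h.ext_of_apply_eq (h1.trans hs.symm) (h2.trans hs'.symm)))
    · exact Or.inr (Or.inr (Or.inl (h.ext_of_apply_eq (h1.trans ht.symm) (h2.trans ht'.symm))))
    · refine Or.inr (Or.inr (Or.inr (h.ext_of_apply_eq ?_ ?_)))
      · rw [h1, AlgEquiv.mul_apply, ht, map_neg, hs]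
      · rw [h2, AlgEquiv.mul_apply, ht', hs']
  · rintro rfl; exact hy hs'.symm
  · rintro rfl; exact hx ht.symm
  · rintro rfl; exact hx (ht.symm.trans hs)

theorem isKleinFour [CharZero K] : IsKleinFour Gal(L/K) := by
  have hsq : ∀ σ : Gal(L/K), σ ^ 2 = 1 := by
    intro σ
    refine h.ext_of_apply_eq ?_ ?_ <;> rw [sq, AlgEquiv.mul_apply, AlgEquiv.one_apply]
    · rcases apply_eq_or_neg_of_sq_mem h.sq_left σ with h1 | h1 <;> simp [h1]
    · rcases apply_eq_or_neg_of_sq_mem h.sq_right σ with h1 | h1 <;> simp [h1]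
  obtain ⟨s, t, hs, ht, hall, hs1, ht1, hst⟩ := h.exists_generators
  have h2 : Monoid.exponent Gal(L/K) = 2 := by
    refine ((Nat.dvd_prime Nat.prime_two).1
      (Monoid.exponent_dvd_of_forall_pow_eq_one hsq)).resolve_left fun h1 ↦ hs1 ?_
    have := Monoid.pow_exponent_eq_one s
    rwa [h1, pow_one] at this
  refine ⟨?_, h2⟩
  have hst1 : s * t ∉ ({s, t, 1} : Set Gal(L/K)) := by
    simpa using mul_notMem_of_exponent_two h2 hs1 ht1 hst
  have huniv : (Set.univ : Set Gal(L/K)) = {s * t, s, t, 1} := by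
    ext σ
    have := hall σ
    simp only [Set.mem_univ, Set.mem_insert_iff, Set.mem_singleton_iff, true_iff]
    tauto
  rw [← Nat.card_univ, huniv, Nat.card_coe_set_eq, Set.ncard_insert_of_notMem hst1,
    Set.ncard_insert_of_notMem (by simp [hst, hs1]), Set.ncard_pair ht1]

theorem finrank_eq_four [CharZero K] : Module.finrank K L = 4 := by
  rw [← IsGalois.card_aut_eq_finrank]
  exact h.isKleinFour.card_four

theorem exists_of_sq_mem [CharZero K] {z : L} (hz : z ^ 2 ∈ (algebraMap K L).range) :
    ∃ c : K, z = algebraMap K L c ∨ z = algebraMap K L c * x ∨ z = algebraMap K L c * y ∨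
      z = algebraMap K L c * (x * y) := by
  obtain ⟨s, t, ⟨hs, hs'⟩, ⟨ht, ht'⟩, hall, -⟩ := h.exists_generators
  have key : ∀ m : L, m ≠ 0 → s (z / m) = z / m → t (z / m) = z / m →
      ∃ c : K, z = algebraMap K L c * m := by
    intro m hm h1 h2
    obtain ⟨c, hc⟩ := mem_range_of_apply_eq hall h1 h2
    exact ⟨c, by rw [hc, div_mul_cancel₀ _ hm]⟩
  have hx := h.left_ne_zero
  have hy := h.right_ne_zero
  rcases apply_eq_or_neg_of_sq_mem hz s with h1 | h1 <;>
  rcases apply_eq_or_neg_of_sq_mem hz t with h2 | h2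
  · obtain ⟨c, hc⟩ := key 1 one_ne_zero (by simp [h1]) (by simp [h2])
    exact ⟨c, Or.inl (by rw [hc, mul_one])⟩
  · obtain ⟨c, hc⟩ := key x hx (by simp [h1, hs]) (by simp [h2, ht])
    exact ⟨c, Or.inr (Or.inl hc)⟩
  · obtain ⟨c, hc⟩ := key y hy (by simp [h1, hs']) (by simp [h2, ht'])
    exact ⟨c, Or.inr (Or.inr (Or.inl hc))⟩
  · obtain ⟨c, hc⟩ := key (x * y) (mul_ne_zero hx hy)
      (by simp [h1, hs, hs', div_neg, neg_div]) (by simp [h2, ht, ht', div_neg, neg_div])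
    exact ⟨c, Or.inr (Or.inr (Or.inr hc))⟩

end IsBiquadratic

theorem isBiquadratic_of_apply_eq [IsGalois K L] [FiniteDimensional K L] [CharZero L]
    {s t : Gal(L/K)} (hall : ∀ σ, σ = 1 ∨ σ = s ∨ σ = t ∨ σ = s * t) {x y : L}
    (hx : x ≠ 0) (hsx : s x = x) (htx : t x = -x) (hy : y ≠ 0) (hsy : s y = -y) (hty : t y = y) :
    IsBiquadratic K x y := by
  have hx' := neg_ne_self.2 hx
  have hy' := neg_ne_self.2 hy
  refine ⟨mem_range_of_apply_eq hall (by rw [map_pow, hsx]) (by rw [map_pow, htx, neg_sq]),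
    mem_range_of_apply_eq hall (by rw [map_pow, hsy, neg_sq]) (by rw [map_pow, hty]),
    fun h ↦ hx' (htx.symm.trans (apply_eq_of_mem_range h t)),
    fun h ↦ hy' (hsy.symm.trans (apply_eq_of_mem_range h s)), fun h ↦ ?_, ?_⟩
  · have hxy := apply_eq_of_mem_range h s
    rw [map_mul, hsx, hsy, mul_neg] at hxy
    exact neg_ne_self.2 (mul_ne_zero hx hy) hxy
  · have hbot : fixingSubgroup (IntermediateField.adjoin K {x, y}) = ⊥ := by
      refine (Subgroup.eq_bot_iff_forall _).2 fun σ hσ ↦ ?_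
      rw [IntermediateField.mem_fixingSubgroup_iff] at hσ
      have hσx := hσ x (IntermediateField.subset_adjoin K _ (by simp))
      have hσy := hσ y (IntermediateField.subset_adjoin K _ (by simp))
      rcases hall σ with rfl | rfl | rfl | rfl
      · rfl
      · exact absurd (hsy.symm.trans hσy) hy'
      · exact absurd (htx.symm.trans hσx) hx'
      · rw [AlgEquiv.mul_apply, htx, map_neg, hsx] at hσx
        exact absurd hσx hx'
    rw [← IsGalois.fixedField_fixingSubgroup (IntermediateField.adjoin K {x, y}), hbot,
      IntermediateField.fixedField_bot]

theorem exists_apply_eq_and_apply_ne [FiniteDimensional K L] {s t : Gal(L/K)}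
    (hs : s ^ 2 = 1) (ht : t ≠ 1) (hst : t ≠ s) : ∃ z : L, s z = z ∧ t z ≠ z := by
  by_contra! hc
  have hmem : t ∈ fixingSubgroup (fixedField (Subgroup.zpowers s)) := by
    rw [IntermediateField.mem_fixingSubgroup_iff]
    intro z hz
    exact hc z ((IntermediateField.mem_fixedField_iff _ _).1 hz s (Subgroup.mem_zpowers s))
  rw [IntermediateField.fixingSubgroup_fixedField, Subgroup.mem_zpowers_iff] at hmem
  obtain ⟨n, rfl⟩ := hmem
  rcases Int.even_or_odd' n with ⟨k, rfl | rfl⟩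
  · exact ht (by rw [zpow_mul, zpow_ofNat, hs, one_zpow])
  · exact hst (by rw [zpow_add, zpow_mul, zpow_ofNat, hs, one_zpow, one_mul, zpow_one])

theorem exists_apply_eq_and_apply_eq_neg [FiniteDimensional K L] {s t : Gal(L/K)}
    (hs : s ^ 2 = 1) (ht : t ^ 2 = 1) (hcomm : Commute s t) (ht1 : t ≠ 1) (hst : t ≠ s) :
    ∃ x : L, x ≠ 0 ∧ s x = x ∧ t x = -x := by
  obtain ⟨z, hz, hz'⟩ := exists_apply_eq_and_apply_ne hs ht1 hst
  have htt : t (t z) = z := by rw [← AlgEquiv.mul_apply, ← sq, ht, AlgEquiv.one_apply]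
  have hst' : s (t z) = t z := by rw [← AlgEquiv.mul_apply, hcomm, AlgEquiv.mul_apply, hz]
  exact ⟨z - t z, sub_ne_zero.2 hz'.symm, by rw [map_sub, hst', hz],
    by rw [map_sub, htt, neg_sub]⟩

end Biquadratic

section Klein

theorem exists_generators_of_isKleinFour (G : Type*) [Group G] [IsKleinFour G] :
    ∃ s t : G, s ≠ 1 ∧ t ≠ 1 ∧ t ≠ s ∧ ∀ g, g = 1 ∨ g = s ∨ g = t ∨ g = s * t := by
  have hcard := IsKleinFour.card_four (G := G)
  have : Finite G := IsKleinFour.instFinite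
  have : Nontrivial G := by
    rw [← Finite.one_lt_card_iff_nontrivial, hcard]
    norm_num
  obtain ⟨s, hs⟩ := exists_ne (1 : G)
  obtain ⟨t, ht⟩ : ∃ t : G, t ∉ ({1, s} : Set G) := by
    by_contra! hc
    have hpair := Set.ncard_pair hs.symm
    have huniv : ({1, s} : Set G) = Set.univ := Set.eq_univ_of_forall hc
    rw [huniv, Set.ncard_univ, hcard] at hpair
    omega
  rw [Set.mem_insert_iff, Set.mem_singleton_iff, not_or] at ht
  refine ⟨s, t, hs, ht.1, ht.2, fun g ↦ ?_⟩
  by_contra! hg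
  exact hg.2.2.2 (IsKleinFour.eq_mul_of_ne_all hs ht.1 (Ne.symm ht.2) hg.1 hg.2.1 hg.2.2.1)

theorem exists_isBiquadratic {K L : Type*} [Field K] [Field L] [Algebra K L] [IsGalois K L]
    [FiniteDimensional K L] [CharZero L] [IsKleinFour Gal(L/K)] :
    ∃ x y : L, IsBiquadratic K x y := by
  have hsq : ∀ s : Gal(L/K), s ^ 2 = 1 := fun s ↦ by rw [sq, IsKleinFour.mul_self]
  have hcomm : ∀ s t : Gal(L/K), Commute s t := IsKleinFour.isMulCommutative.is_comm.comm
  obtain ⟨s, t, hs, ht, hts, hall⟩ := exists_generators_of_isKleinFour Gal(L/K)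
  obtain ⟨x, hx, hsx, htx⟩ :=
    exists_apply_eq_and_apply_eq_neg (hsq s) (hsq t) (hcomm s t) ht hts
  obtain ⟨y, hy, hty, hsy⟩ :=
    exists_apply_eq_and_apply_eq_neg (hsq t) (hsq s) (hcomm t s) hs hts.symm
  exact ⟨x, y, isBiquadratic_of_apply_eq hall hx hsx htx hy hsy hty⟩

instance isKleinFour_V4 : IsKleinFour V4 where
  card_four := by simp [V4]
  exponent_two := by
    rw [Monoid.exponent_prod, Monoid.exponent_multiplicative, ZMod.exponent]
    rfl

end Klein

section SquareRoots

variable {K : Type*} [Field K]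

section

variable {L : Type*} [Field L] [Algebra K L] {a b : Kˣ} {z w : L}

theorem mk_eq_mk_iff_exists_eq_mul (hz : z ^ 2 = algebraMap K L a) (hw : w ^ 2 = algebraMap K L b) :
    (a : SquareClass K) = b ↔ ∃ c : K, z = algebraMap K L c * w := by
  have hinj := (algebraMap K L).injective
  rw [eq_comm, QuotientGroup.eq, Subgroup.mem_square, isSquare_units_iff, Units.val_mul,
    Units.val_inv_eq_inv_val, isSquare_iff_exists_sq]
  constructor
  · rintro ⟨c, hc⟩
    have hzw : z ^ 2 = (algebraMap K L c * w) ^ 2 := by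
      rw [hz, mul_pow, hw, ← map_pow, ← hc, ← map_mul, mul_comm (_⁻¹ : K), mul_assoc,
        inv_mul_cancel₀ b.ne_zero, mul_one]
    rcases sq_eq_sq_iff_eq_or_eq_neg.1 hzw with h | h
    · exact ⟨c, h⟩
    · exact ⟨-c, by rw [h, map_neg, neg_mul]⟩
  · rintro ⟨c, rfl⟩
    refine ⟨c, (inv_mul_eq_iff_eq_mul₀ b.ne_zero).2 (hinj ?_)⟩
    rw [← hz, mul_pow, hw, map_mul, map_pow, mul_comm]

theorem mk_eq_one_iff_mem_range (hz : z ^ 2 = algebraMap K L a) :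
    (a : SquareClass K) = 1 ↔ z ∈ (algebraMap K L).range := by
  rw [← QuotientGroup.mk_one, mk_eq_mk_iff_exists_eq_mul hz (b := 1) (w := 1) (by simp)]
  simp only [mul_one, RingHom.mem_range, eq_comm]

end

theorem mul_self_squareClass (v : SquareClass K) : v * v = 1 := by
  induction v using QuotientGroup.induction_on with
  | H a => exact (QuotientGroup.eq_one_iff (a * a)).2 (IsSquare.mul_self a)

theorem mk_out (v : SquareClass K) : ((Quotient.out v : Kˣ) : SquareClass K) = v :=
  Quotient.out_eq v

/-- A square root of a representative of a square class. -/
def sqrtClass (v : SquareClass K) : AlgebraicClosure K :=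
  (IsAlgClosed.exists_pow_nat_eq (algebraMap K (AlgebraicClosure K) (Quotient.out v : Kˣ))
    two_pos).choose

theorem sqrtClass_sq (v : SquareClass K) :
    sqrtClass v ^ 2 = algebraMap K (AlgebraicClosure K) (Quotient.out v : Kˣ) :=
  (IsAlgClosed.exists_pow_nat_eq (algebraMap K (AlgebraicClosure K) (Quotient.out v : Kˣ))
    two_pos).choose_spec

theorem sqrtClass_mul_sq (v w : SquareClass K) : (sqrtClass v * sqrtClass w) ^ 2 =
    algebraMap K (AlgebraicClosure K) (Quotient.out v * Quotient.out w : Kˣ) := by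
  rw [mul_pow, sqrtClass_sq, sqrtClass_sq, ← map_mul, Units.val_mul]

section

variable {L : IntermediateField K (AlgebraicClosure K)}

theorem mem_of_sq_eq_sq {z w : AlgebraicClosure K} (hz : z ∈ L) (h : z ^ 2 = w ^ 2) : w ∈ L := by
  rcases sq_eq_sq_iff_eq_or_eq_neg.1 h with rfl | rfl
  · exact hz
  · exact neg_mem_iff.1 hz

theorem sqrtClass_mk_mem {z : AlgebraicClosure K} (hz : z ∈ L) {a : Kˣ}
    (h : z ^ 2 = algebraMap K _ a) : sqrtClass (a : SquareClass K) ∈ L := by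
  obtain ⟨c, hc⟩ := (mk_eq_mk_iff_exists_eq_mul (sqrtClass_sq _) h).1 (mk_out (a : SquareClass K))
  exact hc ▸ mul_mem (L.algebraMap_mem c) hz

theorem sqrtClass_mul_mem {v w : SquareClass K} (hv : sqrtClass v ∈ L) (hw : sqrtClass w ∈ L) :
    sqrtClass (v * w) ∈ L := by
  have hvw := sqrtClass_mk_mem (mul_mem hv hw) (sqrtClass_mul_sq v w)
  rwa [QuotientGroup.mk_mul, mk_out, mk_out] at hvw

theorem sqrtClass_mem_of_algEquiv {M : IntermediateField K (AlgebraicClosure K)} (f : L ≃ₐ[K] M)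
    {v : SquareClass K} (hv : sqrtClass v ∈ L) : sqrtClass v ∈ M := by
  have hsq : (⟨sqrtClass v, hv⟩ : L) ^ 2 = algebraMap K L (Quotient.out v : Kˣ) :=
    Subtype.ext (sqrtClass_sq v)
  refine mem_of_sq_eq_sq (f ⟨sqrtClass v, hv⟩).2 ?_
  rw [sqrtClass_sq, ← SubmonoidClass.coe_pow, ← map_pow, hsq, f.commutes]
  rfl

end

end SquareRoots

section BiquadraticFields

variable {K : Type*} [Field K]

/-- The extension `K(√v, √w)` of `K`. -/
def biquadraticField (v w : SquareClass K) : IntermediateField K (AlgebraicClosure K) :=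
  IntermediateField.adjoin K {sqrtClass v, sqrtClass w}

variable (v w : SquareClass K)

theorem sqrtClass_left_mem : sqrtClass v ∈ biquadraticField v w :=
  IntermediateField.subset_adjoin K _ (by simp)

theorem sqrtClass_right_mem : sqrtClass w ∈ biquadraticField v w :=
  IntermediateField.subset_adjoin K _ (by simp)

/-- The square root of `v` as an element of `K(√v, √w)`. -/
def sqrtLeft : biquadraticField v w := ⟨sqrtClass v, sqrtClass_left_mem v w⟩

/-- The square root of `w` as an element of `K(√v, √w)`. -/
def sqrtRight : biquadraticField v w := ⟨sqrtClass w, sqrtClass_right_mem v w⟩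

theorem sqrtLeft_sq :
    sqrtLeft v w ^ 2 = algebraMap K (biquadraticField v w) (Quotient.out v : Kˣ) :=
  Subtype.ext (sqrtClass_sq v)

theorem sqrtRight_sq :
    sqrtRight v w ^ 2 = algebraMap K (biquadraticField v w) (Quotient.out w : Kˣ) :=
  Subtype.ext (sqrtClass_sq w)

theorem sqrtLeft_mul_sqrtRight_sq : (sqrtLeft v w * sqrtRight v w) ^ 2 =
    algebraMap K (biquadraticField v w) (Quotient.out v * Quotient.out w : Kˣ) :=
  Subtype.ext (sqrtClass_mul_sq v w)

variable {v w}

theorem biquadraticField_le_iff {L : IntermediateField K (AlgebraicClosure K)} :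
    biquadraticField v w ≤ L ↔ sqrtClass v ∈ L ∧ sqrtClass w ∈ L := by
  rw [biquadraticField, IntermediateField.adjoin_le_iff, Set.insert_subset_iff,
    Set.singleton_subset_iff]
  rfl

variable (v w) in
instance finiteDimensional_biquadraticField : FiniteDimensional K (biquadraticField v w) :=
  IntermediateField.finiteDimensional_adjoin fun _ _ ↦ Algebra.IsIntegral.isIntegral _

variable (v w) in
instance normal_biquadraticField : Normal K (biquadraticField v w) := by
  rw [IntermediateField.normal_iff_forall_map_le']
  intro σ
  rw [IntermediateField.map_le_iff_le_comap, biquadraticField_le_iff]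
  refine ⟨mem_of_sq_eq_sq (w := σ (sqrtClass v)) (sqrtClass_left_mem v w) ?_,
    mem_of_sq_eq_sq (w := σ (sqrtClass w)) (sqrtClass_right_mem v w) ?_⟩ <;>
  rw [← map_pow, sqrtClass_sq, σ.commutes]

variable (v w) in
instance isGalois_biquadraticField [CharZero K] : IsGalois K (biquadraticField v w) :=
  ⟨⟩

/-- The square classes `v` and `w` are linearly independent in `Kˣ / Kˣ²`, viewed as a vector space
over `𝔽₂`. -/
structure IsIndependentPair (v w : SquareClass K) : Prop where
  left_ne_one : v ≠ 1
  right_ne_one : w ≠ 1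
  mul_ne_one : v * w ≠ 1

theorem isBiquadratic_sqrt_iff : IsBiquadratic K (sqrtLeft v w) (sqrtRight v w) ↔
    IsIndependentPair v w := by
  have htop : IntermediateField.adjoin K {sqrtLeft v w, sqrtRight v w} = ⊤ := by
    refine IntermediateField.map_injective (biquadraticField v w).val ?_
    rw [IntermediateField.adjoin_map, Set.image_pair, ← AlgHom.fieldRange_eq_map,
      IntermediateField.fieldRange_val]
    rfl
  have hv := mk_eq_one_iff_mem_range (sqrtLeft_sq v w)
  have hw := mk_eq_one_iff_mem_range (sqrtRight_sq v w)
  have hvw := mk_eq_one_iff_mem_range (sqrtLeft_mul_sqrtRight_sq v w)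
  rw [mk_out] at hv hw
  rw [QuotientGroup.mk_mul, mk_out, mk_out] at hvw
  exact ⟨fun h ↦ ⟨hv.not.2 h.left_notMem, hw.not.2 h.right_notMem, hvw.not.2 h.mul_notMem⟩,
    fun h ↦ ⟨⟨_, (sqrtLeft_sq v w).symm⟩, ⟨_, (sqrtRight_sq v w).symm⟩, hv.not.1 h.left_ne_one,
      hw.not.1 h.right_ne_one, hvw.not.1 h.mul_ne_one, htop⟩⟩

namespace IsIndependentPair

variable [CharZero K]

theorem isKleinFour (h : IsIndependentPair v w) : IsKleinFour Gal(biquadraticField v w/K) :=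
  (isBiquadratic_sqrt_iff.2 h).isKleinFour

theorem finrank_eq_four (h : IsIndependentPair v w) :
    Module.finrank K (biquadraticField v w) = 4 :=
  (isBiquadratic_sqrt_iff.2 h).finrank_eq_four

theorem hasGaloisClosureGroup (h : IsIndependentPair v w) :
    HasGaloisClosureGroup (biquadraticField v w) V4 := by
  have := h.isKleinFour
  rw [HasGaloisClosureGroup, IntermediateField.normalClosure_of_normal]
  exact IsKleinFour.nonempty_mulEquiv

theorem eq_of_sqrtClass_mem (h : IsIndependentPair v w) {u : SquareClass K}
    (hu : sqrtClass u ∈ biquadraticField v w) : u = 1 ∨ u = v ∨ u = w ∨ u = v * w := by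
  have husq : (⟨sqrtClass u, hu⟩ : biquadraticField v w) ^ 2 =
      algebraMap K (biquadraticField v w) (Quotient.out u : Kˣ) := Subtype.ext (sqrtClass_sq u)
  have hv := mk_eq_mk_iff_exists_eq_mul husq (sqrtLeft_sq v w)
  have hw := mk_eq_mk_iff_exists_eq_mul husq (sqrtRight_sq v w)
  have hvw := mk_eq_mk_iff_exists_eq_mul husq (sqrtLeft_mul_sqrtRight_sq v w)
  have hone := mk_eq_one_iff_mem_range husq
  simp only [QuotientGroup.mk_mul, mk_out] at hv hw hvw hone
  obtain ⟨c, hc | hc | hc | hc⟩ := (isBiquadratic_sqrt_iff.2 h).exists_of_sq_mem ⟨_, husq.symm⟩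
  · exact Or.inl (hone.2 ⟨c, hc.symm⟩)
  · exact Or.inr (Or.inl (hv.2 ⟨c, hc⟩))
  · exact Or.inr (Or.inr (Or.inl (hw.2 ⟨c, hc⟩)))
  · exact Or.inr (Or.inr (Or.inr (hvw.2 ⟨c, hc⟩)))

theorem biquadraticField_eq (h : IsIndependentPair v w)
    {L : IntermediateField K (AlgebraicClosure K)} (hL : Module.finrank K L = 4)
    (hv : sqrtClass v ∈ L) (hw : sqrtClass w ∈ L) : biquadraticField v w = L :=
  have : FiniteDimensional K L := Module.finite_of_finrank_pos (by omega)
  IntermediateField.eq_of_le_of_finrank_eq (biquadraticField_le_iff.2 ⟨hv, hw⟩)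
    (h.finrank_eq_four.trans hL.symm)

end IsIndependentPair

variable [CharZero K]

theorem normalClosure_eq_of_hasGaloisClosureGroup {L : IntermediateField K (AlgebraicClosure K)}
    [FiniteDimensional K L] {G : Type*} [Group G] (hG : HasGaloisClosureGroup L G)
    (hL : Module.finrank K L = Nat.card G) : normalClosure K L (AlgebraicClosure K) = L := by
  obtain ⟨e⟩ := hG
  have : IsGalois K (normalClosure K L (AlgebraicClosure K)) := ⟨⟩
  refine (IntermediateField.eq_of_le_of_finrank_eq (IntermediateField.le_normalClosure L) ?_).symm
  rw [hL, ← Nat.card_congr e.toEquiv, IsGalois.card_aut_eq_finrank]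

theorem exists_eq_biquadraticField_of_isBiquadratic {L : IntermediateField K (AlgebraicClosure K)}
    [IsGalois K L] [FiniteDimensional K L] {x y : L} (h : IsBiquadratic K x y) :
    ∃ v w : SquareClass K, IsIndependentPair v w ∧ L = biquadraticField v w := by
  have exists_unit : ∀ z : L, z ≠ 0 → z ^ 2 ∈ (algebraMap K L).range →
      ∃ a : Kˣ, z ^ 2 = algebraMap K L a := by
    rintro z hz ⟨a, ha⟩
    refine ⟨Units.mk0 a ?_, ha.symm⟩
    rintro rfl
    exact pow_ne_zero 2 hz (by rw [← ha, map_zero])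
  obtain ⟨a, ha⟩ := exists_unit x h.left_ne_zero h.sq_left
  obtain ⟨b, hb⟩ := exists_unit y h.right_ne_zero h.sq_right
  have hab : (x * y) ^ 2 = algebraMap K L (a * b : Kˣ) := by
    rw [mul_pow, ha, hb, ← map_mul, Units.val_mul]
  have hind : IsIndependentPair (a : SquareClass K) b :=
    ⟨(mk_eq_one_iff_mem_range ha).not.2 h.left_notMem,
      (mk_eq_one_iff_mem_range hb).not.2 h.right_notMem,
      (mk_eq_one_iff_mem_range hab).not.2 h.mul_notMem⟩
  exact ⟨a, b, hind, (hind.biquadraticField_eq h.finrank_eq_four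
    (sqrtClass_mk_mem x.2 congr(($ha : AlgebraicClosure K)))
    (sqrtClass_mk_mem y.2 congr(($hb : AlgebraicClosure K)))).symm⟩

theorem exists_eq_biquadraticField {L : IntermediateField K (AlgebraicClosure K)}
    (hL : Module.finrank K L = 4) (hG : HasGaloisClosureGroup L V4) :
    ∃ v w : SquareClass K, IsIndependentPair v w ∧ L = biquadraticField v w := by
  have hfin : FiniteDimensional K L := Module.finite_of_finrank_pos (by omega)
  have hnormal := normalClosure_eq_of_hasGaloisClosureGroup hG
    (hL.trans IsKleinFour.card_four.symm)
  have : Normal K L := IntermediateField.normal_iff_normalClosure_eq.2 hnormal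
  have : IsGalois K L := ⟨⟩
  rw [HasGaloisClosureGroup, hnormal] at hG
  obtain ⟨e⟩ := hG
  have : IsKleinFour Gal(L/K) :=
    ⟨by rw [Nat.card_congr e.toEquiv, IsKleinFour.card_four],
      by rw [Monoid.exponent_eq_of_mulEquiv e, IsKleinFour.exponent_two]⟩
  obtain ⟨x, y, h⟩ := exists_isBiquadratic (K := K) (L := L)
  exact exists_eq_biquadraticField_of_isBiquadratic h

end BiquadraticFields

section LocalRing

open IsLocalRing

variable (R S : Type*) [CommRing R] [IsLocalRing R] [CommRing S] [IsLocalRing S] [Algebra R S]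

theorem inertiaDeg_maximalIdeal_eq_one_iff [(maximalIdeal S).LiesOver (maximalIdeal R)] :
    (maximalIdeal S).inertiaDeg R = 1 ↔
      ∀ z : S, ∃ c : R, z - algebraMap R S c ∈ maximalIdeal S := by
  let := Ideal.Quotient.field (maximalIdeal R)
  rw [Ideal.inertiaDeg_eq_of_isMaximal (maximalIdeal R) (maximalIdeal S),
    Algebra.finrank_eq_one_iff_bijective_algebraMap, Function.Bijective,
    and_iff_right (FaithfulSMul.algebraMap_injective _ _), Function.Surjective,
    Ideal.Quotient.mk_surjective.forall]
  refine forall_congr' fun z ↦ ?_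
  rw [Ideal.Quotient.mk_surjective.exists]
  simp_rw [← Ideal.Quotient.eq, eq_comm (a := Ideal.Quotient.mk _ z)]
  rfl

variable [IsDedekindDomain R] [IsDedekindDomain S] [FaithfulSMul R S] [Module.Finite R S]

theorem ramificationIdx_mul_inertiaDeg_maximalIdeal (hR : maximalIdeal R ≠ ⊥) :
    (maximalIdeal S).ramificationIdx R * (maximalIdeal S).inertiaDeg R = Module.finrank R S := by
  have hprimes : (maximalIdeal R).primesOver S = {maximalIdeal S} := primesOver_eq S hR
  let : Fintype ((maximalIdeal R).primesOver S) := Fintype.ofFinite _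
  rw [← Ideal.sum_ramification_inertia_eq_finrank (maximalIdeal R) S,
    ← Finset.sum_subtype {maximalIdeal S} (by simp [hprimes])
      fun q : Ideal S ↦ q.ramificationIdx R * q.inertiaDeg R, Finset.sum_singleton]

theorem ramificationIdx_maximalIdeal_eq_finrank_iff (hR : maximalIdeal R ≠ ⊥) :
    (maximalIdeal S).ramificationIdx R = Module.finrank R S ↔
      ∀ z : S, ∃ c : R, z - algebraMap R S c ∈ maximalIdeal S := by
  have hmul := ramificationIdx_mul_inertiaDeg_maximalIdeal R S hR
  have : (maximalIdeal S).LiesOver (maximalIdeal R) :=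
    ((primesOver_eq S hR).ge (Set.mem_singleton _)).2
  rw [← inertiaDeg_maximalIdeal_eq_one_iff, ← hmul, eq_comm,
    mul_eq_left₀ (left_ne_zero_of_mul (hmul.trans_ne Module.finrank_pos.ne'))]

end LocalRing

/-- The residue class of the integral element `z` of `L` belongs to the residue field of `K`. -/
def HasResidue (K : Type*) {L : Type*} [Field K] [Field L] [Algebra K L] [Algebra ℚ_[2] L]
    [Algebra.IsAlgebraic ℚ_[2] L] (z : L) : Prop :=
  ∃ c : K, absVal L (z - algebraMap K L c) < 1

section ResidueExtension

variable (K L : Type*) [Field K] [Field L] [Algebra ℤ_[2] K] [Algebra ℤ_[2] L] [Algebra K L]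
  [IsScalarTower ℤ_[2] K L]

/-- The `𝒪_K`-algebra structure of `𝒪_L` in terms of which `IsTotallyRamified` is stated. -/
abbrev integersAlgebra : Algebra (Integers K) (Integers L) := (integersMap K L).toAlgebra

attribute [local instance] integersAlgebra

theorem faithfulSMul_integers : FaithfulSMul (Integers K) (Integers L) :=
  (faithfulSMul_iff_algebraMap_injective _ _).2 fun _ _ h ↦
    Subtype.ext ((algebraMap K L).injective (congrArg Subtype.val h))

theorem isScalarTower_padicInt_integers : IsScalarTower ℤ_[2] (Integers K) (Integers L) :=
  .of_algebraMap_eq fun x ↦ Subtype.ext (IsScalarTower.algebraMap_apply ℤ_[2] K L x)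

theorem isFractionRing_integers [Algebra ℚ_[2] K] [FiniteDimensional ℚ_[2] K]
    [IsScalarTower ℤ_[2] ℚ_[2] K] : IsFractionRing (Integers K) K :=
  integralClosure.isFractionRing_of_finite_extension ℚ_[2] K

variable [Algebra ℚ_[2] L] [FiniteDimensional ℚ_[2] L] [IsScalarTower ℤ_[2] ℚ_[2] L]

theorem finite_integers_integers : Module.Finite (Integers K) (Integers L) :=
  have := isScalarTower_padicInt_integers K L
  .of_restrictScalars_finite ℤ_[2] _ _

theorem sub_mem_maximalIdeal_iff (z : Integers L) (c : Integers K) :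
    z - algebraMap (Integers K) (Integers L) c ∈ IsLocalRing.maximalIdeal (Integers L) ↔
      absVal L (z - algebraMap K L c) < 1 :=
  mem_maxIdeal_iff (F := L) (z - algebraMap (Integers K) (Integers L) c)

variable [Algebra ℚ_[2] K] [FiniteDimensional ℚ_[2] K] [IsScalarTower ℤ_[2] ℚ_[2] K]

theorem finrank_integers_integers :
    Module.finrank (Integers K) (Integers L) = Module.finrank K L := by
  have := isFractionRing_integers K
  have := isFractionRing_integers L
  have : IsScalarTower (Integers K) K L := .of_algebraMap_eq fun _ ↦ rfl
  have : IsScalarTower (Integers K) (Integers L) L := .of_algebraMap_eq fun _ ↦ rfl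
  exact (IsFractionRing.finrank_eq (Integers K) K (Integers L) L).symm

variable [IsScalarTower ℚ_[2] K L]

theorem isTotallyRamified_iff_forall_hasResidue :
    IsTotallyRamified K L ↔ ∀ z : L, absVal L z ≤ 1 → HasResidue K z := by
  have := finite_integers_integers K L
  have := faithfulSMul_integers K L
  have key := ramificationIdx_maximalIdeal_eq_finrank_iff (Integers K) (Integers L)
    (maxIdeal_ne_bot (K := K))
  rw [finrank_integers_integers] at key
  simp_rw [sub_mem_maximalIdeal_iff] at key
  refine key.trans ⟨fun h z hz ↦ ?_, fun h z ↦ ?_⟩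
  · obtain ⟨c, hc⟩ := h ⟨z, (mem_integers_iff_absVal z).2 hz⟩
    exact ⟨c, hc⟩
  · obtain ⟨c, hc⟩ := h z (absVal_le_one_of_integers z)
    have hc1 : absVal K c ≤ 1 := by
      rw [← absVal_algebraMap (L := L), ← sub_sub_cancel (z : L) (algebraMap K L c)]
      exact (absVal_sub_le _ _).trans (max_le (absVal_le_one_of_integers z) hc.le)
    exact ⟨⟨c, (mem_integers_iff_absVal c).2 hc1⟩, hc⟩

end ResidueExtension

section Ramification

variable (K L : Type*) [Field K] [Algebra ℚ_[2] K] [FiniteDimensional ℚ_[2] K]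
  [Algebra ℤ_[2] K] [IsScalarTower ℤ_[2] ℚ_[2] K]
  [Field L] [Algebra ℚ_[2] L] [FiniteDimensional ℚ_[2] L]
  [Algebra ℤ_[2] L] [IsScalarTower ℤ_[2] ℚ_[2] L]
  [Algebra K L] [IsScalarTower ℚ_[2] K L]

theorem exists_rho_eq_pow : ∃ n : ℕ, rho K = rho L ^ n := by
  obtain ⟨n, hn⟩ := exists_absVal_eq (K := L) (c := algebraMap K L (uniformizer K))
    ((map_ne_zero _).2 uniformizer_ne_zero)
  rw [absVal_algebraMap, absVal_uniformizer] at hn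
  have hn_pos : 0 < n := by
    rw [← rho_zpow_lt_zpow_iff (K := L), ← hn, zpow_zero]
    exact rho_lt_one K
  lift n to ℕ using hn_pos.le
  exact ⟨n, by rw [hn, zpow_natCast]⟩

variable {K L}

section RamificationIdx

variable [IsScalarTower ℤ_[2] K L]

attribute [local instance] integersAlgebra

theorem ramificationIdx_maxIdeal_eq {n : ℕ} (h : rho K = rho L ^ n) :
    (maxIdeal L).ramificationIdx (Integers K) = n := by
  have hunder : (maxIdeal L).under (Integers K) = maxIdeal K := by
    ext x
    rw [Ideal.mem_comap, mem_maxIdeal_iff, mem_maxIdeal_iff]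
    exact Iff.of_eq (congrArg (· < 1) (absVal_algebraMap (x : K)))
  have hmap : ((maxIdeal L).under (Integers K)).map (algebraMap (Integers K) (Integers L)) =
      maxIdeal L ^ n := by
    rw [hunder, maxIdeal_eq_span, Ideal.map_span, Set.image_singleton]
    exact span_eq_maxIdeal_pow ((absVal_algebraMap (uniformizer K)).trans h)
  rw [Ideal.IsDedekindDomain.ramificationIdx_eq_multiplicity
    ((maxIdeal L).under (Integers K)) (maxIdeal L), hmap, multiplicity_maxIdeal_pow]
  rw [hmap]
  exact pow_ne_zero n maxIdeal_ne_bot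

theorem isTotallyRamified_iff_rho_eq :
    IsTotallyRamified K L ↔ rho K = rho L ^ Module.finrank K L := by
  obtain ⟨n, hn⟩ := exists_rho_eq_pow K L
  rw [IsTotallyRamified, ramificationIdx_maxIdeal_eq hn, hn, ← zpow_natCast, ← zpow_natCast,
    rho_zpow_inj]
  norm_cast

end RamificationIdx

theorem exists_absVal_mul_uniformizer_pow {n : ℕ} (h : rho K = rho L ^ n) {c : K} (hc : c ≠ 0)
    (i : ℕ) : ∃ m : ℤ, absVal K c = rho K ^ m ∧
      absVal L (algebraMap K L c * uniformizer L ^ i) = rho L ^ (n * m + i) := by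
  obtain ⟨m, hm⟩ := exists_absVal_eq hc
  refine ⟨m, hm, ?_⟩
  rw [map_mul, absVal_algebraMap, hm, map_pow, absVal_uniformizer, h,
    zpow_add₀ (rho_pos L).ne', zpow_mul, zpow_natCast, zpow_natCast]

theorem eq_of_absVal_mul_uniformizer_pow_eq {n : ℕ} (h : rho K = rho L ^ n) {c d : K}
    (hc : c ≠ 0) {i j : Fin n}
    (hij : absVal L (algebraMap K L d * uniformizer L ^ (j : ℕ)) =
      absVal L (algebraMap K L c * uniformizer L ^ (i : ℕ))) : j = i := by
  have hd : d ≠ 0 := by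
    rintro rfl
    rw [map_zero, zero_mul, map_zero, eq_comm, (absVal L).eq_zero] at hij
    exact mul_ne_zero ((map_ne_zero _).2 hc) (pow_ne_zero _ uniformizer_ne_zero) hij
  obtain ⟨m, -, hm⟩ := exists_absVal_mul_uniformizer_pow h hd j
  obtain ⟨l, -, hl⟩ := exists_absVal_mul_uniformizer_pow h hc i
  rw [hm, hl, rho_zpow_inj] at hij
  have hmod := congrArg (· % (n : ℤ)) hij
  simp only [Int.mul_add_emod_self_left] at hmod
  rw [Int.emod_eq_of_lt (by omega) (by omega), Int.emod_eq_of_lt (by omega) (by omega)] at hmod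
  exact Fin.ext (by omega)

theorem absVal_term_le_absVal_sum {n : ℕ} (h : rho K = rho L ^ n) (c : Fin n → K) (i : Fin n) :
    absVal L (algebraMap K L (c i) * uniformizer L ^ (i : ℕ)) ≤
      absVal L (∑ j, algebraMap K L (c j) * uniformizer L ^ (j : ℕ)) := by
  obtain ⟨k, -, hmax⟩ := Finset.exists_max_image Finset.univ
    (fun j ↦ absVal L (algebraMap K L (c j) * uniformizer L ^ (j : ℕ))) ⟨i, Finset.mem_univ i⟩
  refine (hmax i (Finset.mem_univ i)).trans ?_
  rcases eq_or_ne (c k) 0 with hck | hck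
  · rw [hck, map_zero, zero_mul, map_zero]
    exact (absVal L).nonneg _
  exact (IsNonarchimedean.apply_sum_eq_of_lt (f := absVal L) absVal_isNonarchimedean
    (fun a ↦ ((absVal L).map_neg a).symm) (Finset.mem_univ k) fun j _ hj ↦
      (hmax j (Finset.mem_univ j)).lt_of_ne fun heq ↦
        hj (eq_of_absVal_mul_uniformizer_pow_eq h hck heq)).ge

theorem absVal_coeff_le_one {n : ℕ} (h : rho K = rho L ^ n) {c : Fin n → K}
    (hc : absVal L (∑ j, algebraMap K L (c j) * uniformizer L ^ (j : ℕ)) ≤ 1) (i : Fin n) :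
    absVal K (c i) ≤ 1 := by
  have hterm := (absVal_term_le_absVal_sum h c i).trans hc
  rcases eq_or_ne (c i) 0 with hci | hci
  · simp [hci]
  obtain ⟨m, hm, hm'⟩ := exists_absVal_mul_uniformizer_pow h hci i
  rw [hm', ← zpow_zero (rho L), rho_zpow_le_zpow_iff] at hterm
  rw [hm, ← zpow_zero (rho K), rho_zpow_le_zpow_iff]
  by_contra! hm0
  have := i.isLt
  nlinarith

theorem linearIndependent_uniformizer_pow {n : ℕ} (h : rho K = rho L ^ n) :
    LinearIndependent K (fun i : Fin n ↦ uniformizer L ^ (i : ℕ)) := by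
  rw [Fintype.linearIndependent_iff]
  intro c hc i
  simp only [Algebra.smul_def] at hc
  have hle := absVal_term_le_absVal_sum h c i
  rw [hc, map_zero] at hle
  have hzero := (absVal L).eq_zero.1 (hle.antisymm ((absVal L).nonneg _))
  exact (map_eq_zero _).1 ((mul_eq_zero.1 hzero).resolve_right (pow_ne_zero _ uniformizer_ne_zero))

variable [FiniteDimensional K L]

/-- The powers of a uniformizer form a power basis of a totally ramified extension. -/
def uniformizerPowerBasis (h : rho K = rho L ^ Module.finrank K L) : PowerBasis K L where
  gen := uniformizer L
  dim := Module.finrank K L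
  basis := haveI : Nonempty (Fin (Module.finrank K L)) := ⟨⟨0, Module.finrank_pos⟩⟩
    basisOfLinearIndependentOfCardEqFinrank (linearIndependent_uniformizer_pow h) (by simp)
  basis_eq_pow i := by simp

theorem sum_repr_uniformizerPowerBasis (h : rho K = rho L ^ Module.finrank K L) (z : L) :
    ∑ j : Fin (Module.finrank K L),
      algebraMap K L ((uniformizerPowerBasis h).basis.repr z j) * uniformizer L ^ (j : ℕ) = z := by
  have hsum := (uniformizerPowerBasis h).basis.sum_repr z
  simp only [PowerBasis.coe_basis, Algebra.smul_def] at hsum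
  exact hsum

theorem absVal_repr_uniformizerPowerBasis_le_one (h : rho K = rho L ^ Module.finrank K L) {z : L}
    (hz : absVal L z ≤ 1) (i : Fin (Module.finrank K L)) :
    absVal K ((uniformizerPowerBasis h).basis.repr z i) ≤ 1 :=
  absVal_coeff_le_one (c := (uniformizerPowerBasis h).basis.repr z) h
    (by rwa [sum_repr_uniformizerPowerBasis]) i

theorem exists_coeff_of_absVal_le_one (h : rho K = rho L ^ Module.finrank K L) {z : L}
    (hz : absVal L z ≤ 1) : ∃ c : Fin (Module.finrank K L) → K, (∀ i, absVal K (c i) ≤ 1) ∧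
      z = ∑ j, algebraMap K L (c j) * uniformizer L ^ (j : ℕ) :=
  ⟨_, absVal_repr_uniformizerPowerBasis_le_one h hz, (sum_repr_uniformizerPowerBasis h z).symm⟩

open Matrix in
theorem exists_discr_eq_mul_sq (h : rho K = rho L ^ Module.finrank K L)
    {b : Module.Basis (Fin (Module.finrank K L)) K L} (hb : ∀ i, b i ∈ Integers L) :
    ∃ u ∈ Integers K,
      Algebra.discr K b = Algebra.discr K (uniformizerPowerBasis h).basis * u ^ 2 := by
  set P := (uniformizerPowerBasis h).basis.toMatrix b
  have hP : (uniformizerPowerBasis h).basis ᵥ* P.map (algebraMap K L) = b :=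
    Module.Basis.toMatrix_map_vecMul _ _
  have hdiscr := Algebra.discr_of_matrix_vecMul (A := K) (uniformizerPowerBasis h).basis P
  refine ⟨P.det, IsIntegral.det fun i j ↦ ?_, ?_⟩
  · exact (mem_integers_iff_absVal _).2 (absVal_repr_uniformizerPowerBasis_le_one h
      ((mem_integers_iff_absVal _).1 (hb j)) i)
  · rw [mul_comm]
    exact (congrArg (Algebra.discr K) hP.symm).trans hdiscr

variable [IsScalarTower ℤ_[2] K L]

theorem exists_discrIdeal_eq_span (h : rho K = rho L ^ Module.finrank K L) :
    ∃ d : Integers K, (d : K) = Algebra.discr K (uniformizerPowerBasis h).basis ∧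
      discrIdeal K L = Ideal.span {d} := by
  have hint : ∀ i, (uniformizerPowerBasis h).basis i ∈ Integers L := fun i ↦ by
    rw [PowerBasis.coe_basis, mem_integers_iff_absVal, map_pow]
    exact pow_le_one₀ ((absVal L).nonneg _) (rho_lt_one L).le
  refine ⟨⟨_, Algebra.discr_isIntegral K hint⟩, rfl, le_antisymm ?_ ?_⟩
  · rw [discrIdeal, Ideal.span_le]
    rintro d ⟨b, hb, hd⟩
    obtain ⟨u, hu, hbu⟩ := exists_discr_eq_mul_sq h hb
    exact Ideal.mem_span_singleton.2 ⟨⟨u, hu⟩ ^ 2, Subtype.ext (hd.trans hbu)⟩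
  · rw [Ideal.span_singleton_le_iff_mem]
    exact Ideal.subset_span ⟨(uniformizerPowerBasis h).basis, hint, rfl⟩

theorem discrVal_eq_of_absVal_discr (h : rho K = rho L ^ Module.finrank K L) {n : ℕ}
    (hn : absVal K (Algebra.discr K (uniformizerPowerBasis h).basis) = rho K ^ n) :
    discrVal K L = n := by
  obtain ⟨d, hd, hspan⟩ := exists_discrIdeal_eq_span h
  rw [← hd] at hn
  rw [discrVal, hspan, span_eq_maxIdeal_pow hn, multiplicity_maxIdeal_pow]

end Ramification

section GaloisDiscriminant

variable {K L : Type*} [Field K] [Field L] [Algebra K L] [FiniteDimensional K L] [IsGalois K L]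

open Polynomial

theorem minpoly_gen_map_eq_prod (pb : PowerBasis K L) :
    (minpoly K pb.gen).map (algebraMap K L) = ∏ σ : Gal(L/K), (X - C (σ pb.gen)) := by
  have hinj : Function.Injective fun σ : Gal(L/K) ↦ σ pb.gen := fun σ τ h ↦ by
    have : (σ : L →ₐ[K] L) = τ := pb.algHom_ext h
    exact AlgEquiv.ext fun z ↦ DFunLike.congr_fun this z
  have hmonic : (∏ σ : Gal(L/K), (X - C (σ pb.gen))).Monic :=
    monic_prod_of_monic _ _ fun σ _ ↦ monic_X_sub_C _
  refine eq_of_monic_of_dvd_of_natDegree_le hmonic ((minpoly.monic pb.isIntegral_gen).map _)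
    ?_ ?_
  · refine Finset.prod_dvd_of_coprime
      ((pairwise_coprime_X_sub_C hinj).set_pairwise _) fun σ _ ↦ ?_
    rw [dvd_iff_isRoot, IsRoot.def, eval_map_algebraMap, aeval_algHom_apply σ]
    simp
  · rw [natDegree_map, pb.natDegree_minpoly, natDegree_prod_of_monic _ _
      fun σ _ ↦ monic_X_sub_C _]
    simp only [natDegree_X_sub_C, Finset.sum_const, Finset.card_univ, smul_eq_mul, mul_one]
    rw [← pb.finrank, ← IsGalois.card_aut_eq_finrank, Nat.card_eq_fintype_card]

theorem aeval_derivative_minpoly_gen [DecidableEq Gal(L/K)] (pb : PowerBasis K L) :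
    aeval pb.gen (derivative (minpoly K pb.gen)) =
      ∏ σ ∈ Finset.univ.erase (1 : Gal(L/K)), (pb.gen - σ pb.gen) := by
  rw [← eval_map_algebraMap, ← derivative_map, minpoly_gen_map_eq_prod,
    ← Finset.mul_prod_erase _ _ (Finset.mem_univ (1 : Gal(L/K))), derivative_mul]
  simp [eval_prod]

variable [Algebra ℚ_[2] K] [FiniteDimensional ℚ_[2] K] [Algebra ℚ_[2] L]
  [FiniteDimensional ℚ_[2] L] [IsScalarTower ℚ_[2] K L]

theorem absVal_norm (z : L) :
    absVal K (Algebra.norm K z) = absVal L z ^ Module.finrank K L := by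
  rw [← absVal_algebraMap (L := L), Algebra.norm_eq_prod_automorphisms, map_prod]
  simp only [absVal_algEquiv, Finset.prod_const, Finset.card_univ]
  rw [← IsGalois.card_aut_eq_finrank, Nat.card_eq_fintype_card]

variable [Algebra ℤ_[2] K] [IsScalarTower ℤ_[2] ℚ_[2] K] [Algebra ℤ_[2] L]
  [IsScalarTower ℤ_[2] ℚ_[2] L]

theorem absVal_discr_uniformizerPowerBasis [DecidableEq Gal(L/K)]
    (h : rho K = rho L ^ Module.finrank K L) :
    absVal K (Algebra.discr K (uniformizerPowerBasis h).basis) =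
      (∏ σ ∈ Finset.univ.erase (1 : Gal(L/K)), absVal L (uniformizer L - σ (uniformizer L))) ^
        Module.finrank K L := by
  rw [Algebra.discr_powerBasis_eq_norm, map_mul, map_pow, (absVal K).map_neg, map_one, one_pow,
    one_mul, absVal_norm, aeval_derivative_minpoly_gen, map_prod]
  rfl

end GaloisDiscriminant
section QuadraticUniformizer

variable {K L : Type*} [Field K] [Algebra ℚ_[2] K] [FiniteDimensional ℚ_[2] K]
  [Algebra ℤ_[2] K] [IsScalarTower ℤ_[2] ℚ_[2] K]

theorem exists_absVal_div_sq_sub_one_eq {a : Kˣ}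
    (he : (a : SquareClass K) ∈ classFiltration K (absRamificationIdx K))
    (h0 : (a : SquareClass K) ∉ classFiltration K 0) :
    ∃ (s : Kˣ) (j : ℕ), discrExponent K (a : SquareClass K) = 2 * (absRamificationIdx K - j) ∧
      j < absRamificationIdx K ∧ absVal K (a / s ^ 2 : K) = 1 ∧
      absVal K (a / s ^ 2 - 1 : K) = rho K ^ (2 * j + 1) := by
  obtain ⟨m, hm, hmem, hnotMem⟩ := exists_mem_classFiltration_succ_notMem he h0
  obtain ⟨j, hj⟩ : ∃ j, absRamificationIdx K = j + (m + 1) :=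
    ⟨_, (Nat.sub_add_cancel hm).symm⟩
  have hdiscr := discrExponent_of_mem hm hmem hnotMem
  rw [mk_mem_classFiltration, show absRamificationIdx K - (m + 1) = j by omega,
    sup_square_even_eq (by omega), mem_sup_square_iff] at hmem
  rw [mk_mem_classFiltration, show absRamificationIdx K - m = j + 1 by omega,
    mem_sup_square_iff] at hnotMem
  obtain ⟨s, hs⟩ := hmem
  have hs' : ¬ a / s ^ 2 ∈ higherUnits K (2 * (j + 1)) := fun h ↦ hnotMem ⟨s, h⟩
  rw [mem_higherUnits, Units.val_div_eq_div_val, Units.val_pow_eq_pow_val] at hs hs'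
  refine ⟨s, j, by omega, by omega, hs.1, hs.2.antisymm (le_of_not_gt fun hlt ↦ hs' ⟨hs.1, ?_⟩)⟩
  rw [← zpow_natCast (rho K), absVal_lt_rho_zpow_iff] at hlt
  exact_mod_cast hlt

variable [Field L] [Algebra ℚ_[2] L] [Algebra.IsAlgebraic ℚ_[2] L]
  [Algebra K L] [IsScalarTower ℚ_[2] K L]

variable (K L) in
theorem absVal_two_eq_rho_pow : absVal L 2 = rho K ^ absRamificationIdx K := by
  rw [← absVal_two, ← absVal_algebraMap (F := K) (L := L), map_ofNat (algebraMap K L)]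

theorem absVal_sub_one_sq_eq {j : ℕ} (hj : j < absRamificationIdx K) {z : L}
    (hz : absVal L (z ^ 2 - 1) = rho K ^ (2 * j + 1)) :
    absVal L (z - 1) ^ 2 = rho K ^ (2 * j + 1) := by
  have hlt : absVal L 2 < absVal L (z - 1) := by
    by_contra! hle
    have h4 := absVal_sq_sub_one_le hle
    rw [hz, show (4 : L) = 2 ^ 2 by norm_num, map_pow, absVal_two_eq_rho_pow K, ← pow_mul,
      ← zpow_natCast, ← zpow_natCast, rho_zpow_le_zpow_iff] at h4
    push_cast at h4
    omega
  rw [← absVal_sq_sub_one_of_lt hlt, hz]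

variable {a : Kˣ} {y : L}

theorem exists_quadratic_uniformizer_of_mem
    (he : (a : SquareClass K) ∈ classFiltration K (absRamificationIdx K))
    (h0 : (a : SquareClass K) ∉ classFiltration K 0) (hy : y ^ 2 = algebraMap K L a) :
    ∃ c r : K, r ≠ 0 ∧ absVal L ((y - algebraMap K L c) / algebraMap K L r) ^ 2 = rho K ∧
      absVal L (2 * y / algebraMap K L r) ^ 2 = rho K ^ discrExponent K (a : SquareClass K) := by
  obtain ⟨s, j, hdiscr, hj, hs, hs'⟩ := exists_absVal_div_sq_sub_one_eq he h0
  have hρ := rho_pos K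
  have hs0 : algebraMap K L s ≠ 0 := (map_ne_zero _).2 s.ne_zero
  have hys : (y / algebraMap K L s) ^ 2 = algebraMap K L (a / s ^ 2) := by
    rw [div_pow, hy, map_div₀, map_pow]
  have hsub : absVal L (y / algebraMap K L s - 1) ^ 2 = rho K ^ (2 * j + 1) := by
    refine absVal_sub_one_sq_eq hj ?_
    rw [hys, ← hs', ← absVal_algebraMap (F := K) (L := L), map_sub (algebraMap K L),
      map_one (algebraMap K L)]
  refine ⟨s, s * uniformizer K ^ j, mul_ne_zero s.ne_zero (pow_ne_zero _ uniformizer_ne_zero),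
    ?_, ?_⟩
  · rw [map_mul, ← div_div, ← div_sub_one hs0, map_div₀, div_pow, hsub, absVal_algebraMap, map_pow,
      absVal_uniformizer, pow_succ, mul_comm 2, pow_mul, mul_div_cancel_left₀ _ (by positivity)]
  · have hone : absVal L (y / algebraMap K L s) ^ 2 = 1 := by
      rw [← map_pow, hys, absVal_algebraMap, hs]
    rw [map_mul, ← div_div, mul_div_assoc, map_div₀, map_mul, div_pow, mul_pow, hone, mul_one,
      absVal_two_eq_rho_pow K, absVal_algebraMap, map_pow, absVal_uniformizer, ← pow_mul,
      ← pow_mul, div_eq_iff (by positivity), ← pow_add, hdiscr]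
    congr 1
    omega

theorem exists_quadratic_uniformizer_of_notMem
    (he : (a : SquareClass K) ∉ classFiltration K (absRamificationIdx K))
    (hy : y ^ 2 = algebraMap K L a) :
    ∃ r : K, r ≠ 0 ∧ absVal L (y / algebraMap K L r) ^ 2 = rho K ∧
      absVal L (2 * y / algebraMap K L r) ^ 2 = rho K ^ discrExponent K (a : SquareClass K) := by
  rw [discrExponent_of_notMem he]
  rw [mk_mem_classFiltration, Nat.sub_self, mul_zero, mem_sup_square_zero_iff] at he
  obtain ⟨n, hn⟩ := exists_absVal_eq a.ne_zero
  obtain ⟨k, rfl | rfl⟩ := Int.even_or_odd' n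
  · exact absurd ⟨k, hn⟩ he
  have hyk : absVal L (y / algebraMap K L (uniformizer K ^ k)) ^ 2 = rho K := by
    rw [← map_pow, div_pow, hy, map_div₀, map_pow, absVal_algebraMap, absVal_algebraMap, hn,
      map_zpow₀, absVal_uniformizer, div_eq_iff (pow_ne_zero _ (zpow_ne_zero _ (rho_pos K).ne')),
      ← zpow_natCast, ← zpow_mul, ← zpow_one_add₀ (rho_pos K).ne']
    congr 1
    push_cast
    ring
  refine ⟨uniformizer K ^ k, zpow_ne_zero _ uniformizer_ne_zero, hyk, ?_⟩
  rw [mul_div_assoc, map_mul, mul_pow, hyk, absVal_two_eq_rho_pow K, ← pow_mul, ← pow_succ,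
    mul_comm 2]

theorem exists_quadratic_uniformizer (ha : (a : SquareClass K) ∉ classFiltration K 0)
    (hy : y ^ 2 = algebraMap K L a) :
    ∃ c r : K, r ≠ 0 ∧ absVal L ((y - algebraMap K L c) / algebraMap K L r) ^ 2 = rho K ∧
      absVal L (2 * y / algebraMap K L r) ^ 2 = rho K ^ discrExponent K (a : SquareClass K) := by
  by_cases he : (a : SquareClass K) ∈ classFiltration K (absRamificationIdx K)
  · exact exists_quadratic_uniformizer_of_mem he ha hy
  · obtain ⟨r, hr, hunif, hconj⟩ := exists_quadratic_uniformizer_of_notMem he hy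
    exact ⟨0, r, hr, by rwa [map_zero, sub_zero], hconj⟩

variable {u : L} (hu : absVal L u ^ 2 = rho K)

include hu

theorem absVal_algebraMap_ne_absVal_mul {A B : K} (hB : B ≠ 0) :
    absVal L (algebraMap K L A) ≠ absVal L (algebraMap K L B * u) := by
  intro h
  have hsq : absVal K A ^ 2 = absVal K B ^ 2 * rho K := by
    rw [← hu, ← mul_pow, ← absVal_algebraMap (L := L) A, h, map_mul, absVal_algebraMap]
  have hA : A ≠ 0 := by
    rintro rfl
    rw [map_zero, zero_pow two_ne_zero] at hsq
    exact (mul_pos (pow_pos ((absVal K).pos hB) 2) (rho_pos K)).ne hsq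
  obtain ⟨m, hm⟩ := exists_absVal_eq hA
  obtain ⟨n, hn⟩ := exists_absVal_eq hB
  rw [hm, hn, ← zpow_natCast, ← zpow_natCast, ← zpow_mul, ← zpow_mul,
    ← zpow_add_one₀ (rho_pos K).ne', rho_zpow_inj] at hsq
  push_cast at hsq
  omega

theorem absVal_mul_le_of_sq_eq_rho (A B : K) :
    absVal L (algebraMap K L B * u) ≤ absVal L (algebraMap K L A + algebraMap K L B * u) := by
  rcases eq_or_ne B 0 with rfl | hB
  · simp
  rcases (absVal_algebraMap_ne_absVal_mul hu (A := A) hB).lt_or_gt with h | h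
  · exact (absVal_add_of_lt h).ge
  · rw [add_comm, absVal_add_of_lt h]
    exact h.le

theorem absVal_le_one_of_sq_eq_rho {B : K} (h : absVal L (algebraMap K L B * u) ≤ 1) :
    absVal K B ≤ 1 := by
  rcases eq_or_ne B 0 with rfl | hB
  · simp
  obtain ⟨n, hn⟩ := exists_absVal_eq hB
  have hsq := pow_le_one₀ ((absVal L).nonneg _) h (n := 2)
  rw [map_mul, absVal_algebraMap, mul_pow, hu, hn, ← zpow_natCast, ← zpow_mul,
    ← zpow_add_one₀ (rho_pos K).ne', ← zpow_zero (rho K), rho_zpow_le_zpow_iff] at hsq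
  rw [hn, ← zpow_zero (rho K), rho_zpow_le_zpow_iff]
  push_cast at hsq
  omega

end QuadraticUniformizer

/-- Two commuting involutions `σ` and `τ` of `L / K` with common fixed field `K`. Their product may
be trivial, so that `L / K` may also be quadratic. -/
structure IsInvolutionPair {K L : Type*} [Field K] [Field L] [Algebra K L] (σ τ : Gal(L/K)) :
    Prop where
  left : ∀ z, σ (σ z) = z
  right : ∀ z, τ (τ z) = z
  comm : ∀ z, σ (τ z) = τ (σ z)
  mem_range : ∀ z, τ z = z → σ z = z → z ∈ (algebraMap K L).range

namespace IsInvolutionPair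

variable {K L : Type*} [Field K] [Field L] [Algebra K L] {σ τ : Gal(L/K)}

theorem exists_eq_add_mul [CharZero L] (h : IsInvolutionPair σ τ) {y : L} (hσ : σ y = -y)
    (hτ : τ y = y) (hy : y ≠ 0) {z : L} (hz : τ z = z) :
    ∃ A B : K, z = algebraMap K L A + algebraMap K L B * y := by
  obtain ⟨A, hA⟩ := h.mem_range ((z + σ z) / 2)
    (by rw [map_div₀, map_add, ← h.comm, hz, map_ofNat])
    (by rw [map_div₀, map_add, h.left, map_ofNat, add_comm])
  obtain ⟨B, hB⟩ := h.mem_range ((z - σ z) / (2 * y))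
    (by rw [map_div₀, map_sub, ← h.comm, hz, map_mul, map_ofNat, hτ])
    (by rw [map_div₀, map_sub, h.left, map_mul, map_ofNat, hσ, mul_neg, div_neg, ← neg_div,
      neg_sub])
  refine ⟨A, B, ?_⟩
  rw [hA, hB]
  field_simp
  ring

variable [Algebra ℚ_[2] K] [Algebra ℚ_[2] L] [Algebra.IsAlgebraic ℚ_[2] L]
  [IsScalarTower ℚ_[2] K L]

theorem absVal_sub_le [FiniteDimensional ℚ_[2] K] [Algebra ℤ_[2] K] [IsScalarTower ℤ_[2] ℚ_[2] K]
    (h : IsInvolutionPair σ τ) {y : L} (hσ : σ y = -y) (hτ : τ y = y) (hy : y ≠ 0) {c r : K}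
    (hr : r ≠ 0) (hu : absVal L ((y - algebraMap K L c) / algebraMap K L r) ^ 2 = rho K)
    {z : L} (hz : τ z = z) (hz1 : absVal L z ≤ 1) :
    absVal L (σ z - z) ≤ absVal L (2 * y / algebraMap K L r) := by
  have := charZero_of_algebra_padic L
  obtain ⟨A, B, rfl⟩ := h.exists_eq_add_mul hσ hτ hy hz
  have hr' : algebraMap K L r ≠ 0 := (map_ne_zero _).2 hr
  have hz' : algebraMap K L A + algebraMap K L B * y = algebraMap K L (A + B * c) +
      algebraMap K L (B * r) * ((y - algebraMap K L c) / algebraMap K L r) := by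
    rw [map_add, map_mul, map_mul]
    field_simp
    ring
  have hBr : absVal K (B * r) ≤ 1 := absVal_le_one_of_sq_eq_rho hu
    ((absVal_mul_le_of_sq_eq_rho hu (A + B * c) (B * r)).trans (hz' ▸ hz1))
  have hsub : σ (algebraMap K L A + algebraMap K L B * y) -
      (algebraMap K L A + algebraMap K L B * y) =
        -(algebraMap K L (B * r) * (2 * y / algebraMap K L r)) := by
    rw [map_add, map_mul, σ.commutes, σ.commutes, hσ, map_mul]
    field_simp
    ring
  rw [hsub, (absVal L).map_neg, map_mul, absVal_algebraMap]
  exact mul_le_of_le_one_left ((absVal L).nonneg _) hBr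

theorem mul_le_absVal_sub (h : IsInvolutionPair σ τ) {ε : ℝ}
    (hε : ∀ z, τ z = z → absVal L z ≤ 1 → absVal L (σ z - z) ≤ ε) {ϖ : L} (hϖ : absVal L ϖ ≤ 1) :
    absVal L (ϖ - σ ϖ) * absVal L (ϖ - σ (τ ϖ)) ≤ ε := by
  have hτϖ : absVal L (τ ϖ) ≤ 1 := by rwa [absVal_algEquiv]
  have htrace := hε (ϖ + τ ϖ) (by rw [map_add, h.right, add_comm])
    ((absVal_add_le _ _).trans (max_le hϖ hτϖ))
  have hnorm := hε (ϖ * τ ϖ) (by rw [map_mul, h.right, mul_comm])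
    (by rw [map_mul]; exact mul_le_one₀ hϖ ((absVal L).nonneg _) hτϖ)
  have hexpand : (ϖ - σ ϖ) * (ϖ - σ (τ ϖ)) =
      (σ (ϖ * τ ϖ) - ϖ * τ ϖ) - (σ (ϖ + τ ϖ) - (ϖ + τ ϖ)) * ϖ := by
    rw [map_mul, map_add]
    ring
  rw [← map_mul, hexpand]
  refine (TwoAdic.absVal_sub_le _ _).trans (max_le hnorm ?_)
  rw [map_mul]
  exact (mul_le_of_le_one_right ((absVal L).nonneg _) hϖ).trans htrace

end IsInvolutionPair

open Polynomial in
theorem exists_eval_sub_eval_eq_mul {R : Type*} [CommRing R] [IsDomain R] (p : R[X]) {a b : R}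
    (hab : a ≠ b) (h : p.eval a = p.eval b) (c : R) :
    ∃ d, p.eval c - p.eval a = (c - a) * (c - b) * d := by
  obtain ⟨f, hf⟩ := X_sub_C_dvd_sub_C_eval (a := a) (p := p)
  have hfb : f.IsRoot b := by
    have hb := congrArg (eval b) hf
    rw [eval_sub, eval_C, h, sub_self, eval_mul, eval_sub, eval_X, eval_C] at hb
    exact (mul_eq_zero.1 hb.symm).resolve_left (sub_ne_zero.2 hab.symm)
  obtain ⟨g, rfl⟩ := dvd_iff_isRoot.2 hfb
  have hc := congrArg (eval c) hf
  simp only [eval_sub, eval_C, eval_mul, eval_X, ← mul_assoc] at hc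
  exact ⟨g.eval c, hc⟩

section TotallyRamified

variable {K L : Type*} [Field K] [Algebra ℚ_[2] K] [FiniteDimensional ℚ_[2] K]
  [Algebra ℤ_[2] K] [IsScalarTower ℤ_[2] ℚ_[2] K]
  [Field L] [Algebra ℚ_[2] L] [FiniteDimensional ℚ_[2] L]
  [Algebra ℤ_[2] L] [IsScalarTower ℤ_[2] ℚ_[2] L]
  [Algebra K L] [IsScalarTower ℚ_[2] K L] [FiniteDimensional K L]

theorem exists_polynomial_forall_eval_eq (htot : rho K = rho L ^ Module.finrank K L) {u : L}
    (hu : absVal L u ≤ 1) : ∃ p : Polynomial (Integers L), ∀ (σ : Gal(L/K)) (z : Integers L),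
      (z : L) = σ (uniformizer L) → ((p.eval z : Integers L) : L) = σ u := by
  obtain ⟨c, hc, rfl⟩ := exists_coeff_of_absVal_le_one htot hu
  have hint (j) : algebraMap K L (c j) ∈ Integers L :=
    (mem_integers_iff_absVal _).2 ((absVal_algebraMap (c j)).trans_le (hc j))
  refine ⟨∑ j : Fin _, Polynomial.C ⟨_, hint j⟩ * Polynomial.X ^ (j : ℕ), fun σ z hz ↦ ?_⟩
  rw [Polynomial.eval_finsetSum, AddSubmonoidClass.coe_finsetSum, map_sum]
  simp [hz]

theorem absVal_apply_sub_le_mul {σ τ : Gal(L/K)} (htot : rho K = rho L ^ Module.finrank K L)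
    (hτ : τ (uniformizer L) ≠ uniformizer L) {u : L} (hu : absVal L u ≤ 1) (hτu : τ u = u) :
    absVal L (σ u - u) ≤ absVal L (uniformizer L - σ (uniformizer L)) *
      absVal L (uniformizer L - σ (τ (uniformizer L))) := by
  obtain ⟨p, hp⟩ := exists_polynomial_forall_eval_eq htot hu
  have hint (ρ : Gal(L/K)) : ρ (uniformizer L) ∈ Integers L :=
    (mem_integers_iff_absVal _).2 ((absVal_algEquiv ρ _).trans_le (rho_lt_one L).le)
  -- Writing `u = p(ϖ)` with `p` over `𝒪_K`, both `σϖ` and `στϖ` are roots of `p - σu`.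
  obtain ⟨d, hd⟩ := exists_eval_sub_eval_eq_mul p (a := ⟨_, hint σ⟩) (b := ⟨_, hint (σ * τ)⟩)
    (fun h ↦ hτ (σ.injective (congrArg Subtype.val h)).symm)
    (Subtype.ext (by rw [hp σ _ rfl, hp (σ * τ) _ rfl, AlgEquiv.mul_apply, hτu]))
    (uniformizerInt L)
  have hd' := congrArg (absVal L ∘ Subtype.val) hd
  simp only [Function.comp_apply, AddSubgroupClass.coe_sub, MulMemClass.coe_mul, map_mul,
    hp σ ⟨_, hint σ⟩ rfl, hp 1 (uniformizerInt L) rfl, AlgEquiv.one_apply] at hd'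
  rw [← (absVal L).map_neg, neg_sub, hd']
  exact mul_le_of_le_one_right (mul_nonneg ((absVal L).nonneg _) ((absVal L).nonneg _))
    (absVal_le_one_of_integers d)

theorem IsInvolutionPair.mul_sq_eq {σ τ : Gal(L/K)} (h : IsInvolutionPair σ τ)
    (htot : rho K = rho L ^ Module.finrank K L) (hτϖ : τ (uniformizer L) ≠ uniformizer L) {a : Kˣ}
    (ha : (a : SquareClass K) ∉ classFiltration K 0) {y : L} (hy : y ^ 2 = algebraMap K L a)
    (hσ : σ y = -y) (hτ : τ y = y) :
    (absVal L (uniformizer L - σ (uniformizer L)) *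
      absVal L (uniformizer L - σ (τ (uniformizer L)))) ^ 2 =
        rho K ^ discrExponent K (a : SquareClass K) := by
  have hy0 : y ≠ 0 := by
    rintro rfl
    rw [zero_pow two_ne_zero, eq_comm, map_eq_zero] at hy
    exact a.ne_zero hy
  obtain ⟨c, r, hr, hu, hd⟩ := exists_quadratic_uniformizer ha hy
  set u := (y - algebraMap K L c) / algebraMap K L r with hu_def
  have hσu : σ u - u = -(2 * y / algebraMap K L r) := by
    rw [hu_def, map_div₀, map_sub, hσ, σ.commutes, σ.commutes]
    ring
  have hτu : τ u = u := by rw [hu_def, map_div₀, map_sub, hτ, τ.commutes, τ.commutes]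
  have hu1 : absVal L u ≤ 1 :=
    (pow_le_one_iff_of_nonneg ((absVal L).nonneg _) two_ne_zero).1 (hu.trans_le (rho_lt_one K).le)
  rw [← hd]
  congr 1
  refine le_antisymm (h.mul_le_absVal_sub
    (fun z hz hz1 ↦ h.absVal_sub_le hσ hτ hy0 hr hu hz hz1) (rho_lt_one L).le) ?_
  have hle := absVal_apply_sub_le_mul (σ := σ) htot hτϖ hu1 hτu
  rwa [hσu, (absVal L).map_neg] at hle

end TotallyRamified

section UnramifiedClass

variable {K L : Type*} [Field K] [Algebra ℚ_[2] K] [Field L] [Algebra ℚ_[2] L]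
  [Algebra.IsAlgebraic ℚ_[2] L] [Algebra K L] [IsScalarTower ℚ_[2] K L]

theorem absVal_le_one_of_absVal_mul_add_one_le {θ : L} (h : absVal L (θ * (θ + 1)) ≤ 1) :
    absVal L θ ≤ 1 := by
  by_contra! hlt
  have hadd : absVal L (θ + 1) = absVal L θ := by
    rw [add_comm]
    exact absVal_add_of_lt (by rwa [map_one])
  rw [map_mul, hadd] at h
  nlinarith

theorem not_hasResidue_of_apply_eq_neg_one_sub {σ : Gal(L/K)} {θ : L} (hθ : absVal L θ ≤ 1)
    (hσθ : σ θ = -1 - θ) : ¬ HasResidue K θ := by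
  rintro ⟨c, hc⟩
  have hσc : absVal L (-1 - θ - algebraMap K L c) < 1 := by
    rwa [← hσθ, ← σ.commutes c, ← map_sub, absVal_algEquiv]
  have hc1 : absVal L (algebraMap K L c) ≤ 1 := by
    rw [← sub_sub_cancel θ (algebraMap K L c)]
    exact (absVal_sub_le _ _).trans (max_le hθ hc.le)
  have h2c : absVal L (2 * algebraMap K L c) < 1 := by
    rw [map_mul]
    exact mul_lt_one_of_nonneg_of_lt_one_left ((absVal L).nonneg _) absVal_two_lt_one hc1
  have hone : absVal L 1 < 1 := by
    rw [show (1 : L) = -((θ - algebraMap K L c) + (-1 - θ - algebraMap K L c)) -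
      2 * algebraMap K L c by ring]
    refine (absVal_sub_le _ _).trans_lt (max_lt ?_ h2c)
    rw [(absVal L).map_neg]
    exact (absVal_add_le _ _).trans_lt (max_lt hc hσc)
  exact hone.ne (map_one _)

variable [FiniteDimensional ℚ_[2] K] [Algebra ℤ_[2] K] [IsScalarTower ℤ_[2] ℚ_[2] K]

theorem exists_apply_eq_neg_one_sub {a : Kˣ} (ha : (a : SquareClass K) ∈ classFiltration K 0)
    {y : L} (hy : y ^ 2 = algebraMap K L a) {σ : Gal(L/K)} (hσ : σ y = -y) :
    ∃ θ : L, absVal L θ ≤ 1 ∧ σ θ = -1 - θ := by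
  have := charZero_of_algebra_padic L
  rw [mk_mem_classFiltration, Nat.sub_zero, mem_sup_square_iff] at ha
  obtain ⟨s, -, hs⟩ := ha
  rw [Units.val_div_eq_div_val, Units.val_pow_eq_pow_val, ← absVal_four] at hs
  set θ : L := (y / algebraMap K L s - 1) / 2 with hθ_def
  have hθ : θ * (θ + 1) = algebraMap K L ((a / s ^ 2 - 1) / 4) := by
    rw [map_div₀, map_sub, map_one, map_div₀, map_pow, ← hy, map_ofNat, hθ_def]
    field_simp
    ring
  refine ⟨θ, absVal_le_one_of_absVal_mul_add_one_le ?_, ?_⟩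
  · rw [hθ, absVal_algebraMap, map_div₀]
    exact div_le_one_of_le₀ hs ((absVal K).nonneg _)
  · rw [hθ_def, map_div₀, map_sub, map_div₀, hσ, σ.commutes, map_one, map_ofNat]
    field_simp
    ring

theorem notMem_classFiltration_zero_of_isTotallyRamified [FiniteDimensional ℚ_[2] L]
    [Algebra ℤ_[2] L] [IsScalarTower ℤ_[2] ℚ_[2] L] [IsScalarTower ℤ_[2] K L]
    (htot : IsTotallyRamified K L) {a : Kˣ} {y : L} (hy : y ^ 2 = algebraMap K L a)
    {σ : Gal(L/K)} (hσ : σ y = -y) : (a : SquareClass K) ∉ classFiltration K 0 := by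
  intro ha
  obtain ⟨θ, hθ, hσθ⟩ := exists_apply_eq_neg_one_sub ha hy hσ
  exact not_hasResidue_of_apply_eq_neg_one_sub hθ hσθ
    ((isTotallyRamified_iff_forall_hasResidue K L).1 htot θ hθ)

end UnramifiedClass
section KleinFour

theorem mul_ne_one_of_isKleinFour {G : Type*} [Group G] [IsKleinFour G] {s t : G} (hst : s ≠ t) :
    s * t ≠ 1 :=
  fun h ↦ hst (mul_right_cancel (h.trans (IsKleinFour.mul_self t).symm))

theorem prod_univ_erase_one_of_isKleinFour {G M : Type*} [Group G] [IsKleinFour G] [Fintype G]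
    [DecidableEq G] [CommMonoid M] {s t : G} (hs : s ≠ 1) (ht : t ≠ 1) (hst : s ≠ t) (f : G → M) :
    ∏ g ∈ Finset.univ.erase 1, f g = f s * f t * f (s * t) := by
  have hs' : s * t ≠ t := fun h ↦ hs (mul_eq_right.1 h)
  have ht' : s * t ≠ s := fun h ↦ ht (mul_eq_left.1 h)
  have huniv : Finset.univ.erase (1 : G) = {s * t, s, t} := by
    rw [← IsKleinFour.eq_finset_univ hs ht hst]
    ext g
    simp only [Finset.mem_erase, Finset.mem_insert, Finset.mem_singleton]
    constructor
    · tauto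
    · rintro (rfl | rfl | rfl) <;> simp [hs, ht, mul_ne_one_of_isKleinFour hst]
  rw [huniv, Finset.prod_insert (by simp [hs', ht']), Finset.prod_insert (by simp [hst]),
    Finset.prod_singleton, mul_comm]

theorem isInvolutionPair_of_isKleinFour {K L : Type*} [Field K] [Field L] [Algebra K L]
    [FiniteDimensional K L] [IsGalois K L] [IsKleinFour Gal(L/K)] {σ τ : Gal(L/K)}
    (hσ : σ ≠ 1) (hτ : τ ≠ 1) (hne : σ ≠ τ) : IsInvolutionPair σ τ := by
  classical
  refine ⟨fun z ↦ ?_, fun z ↦ ?_, fun z ↦ ?_, fun z hz hz' ↦ ?_⟩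
  · rw [← AlgEquiv.mul_apply, IsKleinFour.mul_self, AlgEquiv.one_apply]
  · rw [← AlgEquiv.mul_apply, IsKleinFour.mul_self, AlgEquiv.one_apply]
  · rw [← AlgEquiv.mul_apply, ← AlgEquiv.mul_apply,
      mul_comm_of_exponent_two IsKleinFour.exponent_two]
  · refine mem_range_of_forall_fixed fun ρ ↦ ?_
    have hρ : ρ ∈ (Finset.univ : Finset Gal(L/K)) := Finset.mem_univ _
    rw [← IsKleinFour.eq_finset_univ hσ hτ hne] at hρ
    simp only [Finset.mem_insert, Finset.mem_singleton] at hρ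
    rcases hρ with rfl | rfl | rfl | rfl
    · rw [AlgEquiv.mul_apply, hz, hz']
    · exact hz'
    · exact hz
    · rfl

end KleinFour

section ConductorDiscriminant

variable {K L : Type*} [Field K] [Algebra ℚ_[2] K] [FiniteDimensional ℚ_[2] K]
  [Algebra ℤ_[2] K] [IsScalarTower ℤ_[2] ℚ_[2] K]
  [Field L] [Algebra ℚ_[2] L] [FiniteDimensional ℚ_[2] L]
  [Algebra ℤ_[2] L] [IsScalarTower ℤ_[2] ℚ_[2] L]
  [Algebra K L] [IsScalarTower ℚ_[2] K L] [FiniteDimensional K L]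

theorem apply_uniformizer_ne (htot : rho K = rho L ^ Module.finrank K L) {σ : Gal(L/K)}
    (hσ : σ ≠ 1) : σ (uniformizer L) ≠ uniformizer L := by
  intro h
  have hid : (σ : L →ₐ[K] L) = AlgHom.id K L := (uniformizerPowerBasis htot).algHom_ext h
  exact hσ (AlgEquiv.ext fun z ↦ DFunLike.congr_fun hid z)

variable [IsScalarTower ℤ_[2] K L] [IsGalois K L]

theorem mul_sq_eq_of_isKleinFour [IsKleinFour Gal(L/K)] (htot : IsTotallyRamified K L)
    {σ τ : Gal(L/K)} (hσ : σ ≠ 1) (hτ : τ ≠ 1) (hne : σ ≠ τ) {a : Kˣ} {y : L}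
    (hy : y ^ 2 = algebraMap K L a) (hσy : σ y = -y) (hτy : τ y = y) :
    (absVal L (uniformizer L - σ (uniformizer L)) *
      absVal L (uniformizer L - (σ * τ) (uniformizer L))) ^ 2 =
        rho K ^ discrExponent K (a : SquareClass K) := by
  have hrho := isTotallyRamified_iff_rho_eq.1 htot
  exact (isInvolutionPair_of_isKleinFour hσ hτ hne).mul_sq_eq hrho (apply_uniformizer_ne hrho hτ)
    (notMem_classFiltration_zero_of_isTotallyRamified htot hy hσy) hy hσy hτy

theorem IsBiquadratic.discrVal_eq {x y : L} (h : IsBiquadratic K x y)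
    (htot : IsTotallyRamified K L) {a b : Kˣ} (hx : x ^ 2 = algebraMap K L a)
    (hy : y ^ 2 = algebraMap K L b) :
    discrVal K L = discrExponent K (a : SquareClass K) + discrExponent K (b : SquareClass K) +
      discrExponent K ((a * b : Kˣ) : SquareClass K) := by
  classical
  have := charZero_of_algebra_padic K
  have := h.isKleinFour
  obtain ⟨s, t, ⟨hsx, hsy⟩, ⟨htx, hty⟩, -, hs1, ht1, hst⟩ := h.exists_generators
  have hs_mul : s * (s * t) = t := by rw [← mul_assoc, IsKleinFour.mul_self, one_mul]
  have hts : t * s = s * t := mul_comm_of_exponent_two IsKleinFour.exponent_two t s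
  have hxy : (x * y) ^ 2 = algebraMap K L (a * b : Kˣ) := by
    rw [mul_pow, hx, hy, Units.val_mul, map_mul]
  have hsxy : s (x * y) = -(x * y) := by rw [map_mul, hsx, hsy, mul_neg]
  have hstxy : (s * t) (x * y) = x * y := by
    rw [AlgEquiv.mul_apply, map_mul t, htx, hty, map_mul, map_neg, hsx, hsy, neg_mul_neg]
  have hda := mul_sq_eq_of_isKleinFour htot ht1 hs1 hst.symm hx htx hsx
  have hdb := mul_sq_eq_of_isKleinFour htot hs1 ht1 hst hy hsy hty
  have hdab := mul_sq_eq_of_isKleinFour htot hs1 (mul_ne_one_of_isKleinFour hst)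
    (fun h1 ↦ ht1 (left_eq_mul.1 h1)) hxy hsxy hstxy
  rw [hts] at hda
  rw [hs_mul] at hdab
  refine discrVal_eq_of_absVal_discr (isTotallyRamified_iff_rho_eq.1 htot) ?_
  rw [absVal_discr_uniformizerPowerBasis, prod_univ_erase_one_of_isKleinFour hs1 ht1 hst,
    h.finrank_eq_four, pow_add, pow_add, ← hda, ← hdb, ← hdab]
  ring

end ConductorDiscriminant

theorem exists_eq_one_sub_four_mul {K : Type*} [Field K] [Algebra ℚ_[2] K]
    [FiniteDimensional ℚ_[2] K] [Algebra ℤ_[2] K] [IsScalarTower ℤ_[2] ℚ_[2] K] {x : K}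
    (hx : absVal K x ≤ 1) :
    ∃ a : Kˣ, (a : K) = 1 - 4 * x ∧ (a : SquareClass K) ∈ classFiltration K 0 := by
  have hsmall : absVal K (1 - (1 - 4 * x)) ≤ rho K ^ (2 * absRamificationIdx K) := by
    rw [sub_sub_cancel, map_mul, absVal_four]
    exact mul_le_of_le_one_right (pow_pos (rho_pos K) _).le hx
  have hone : absVal K (1 - 4 * x) = 1 :=
    absVal_eq_one_of_sub_lt (map_one _) (hsmall.trans_lt
      (rho_pow_lt_one (by have := absRamificationIdx_pos K; lia)))
  refine ⟨Units.mk0 _ ((absVal K).ne_zero_iff.1 (hone.trans_ne one_ne_zero)), rfl, ?_⟩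
  rw [mk_mem_classFiltration]
  refine Subgroup.mem_sup_left (mem_higherUnits.2 ⟨hone, ?_⟩)
  rwa [Units.val_mk0, ← (absVal K).map_neg, neg_sub]

section ResidueField

variable {K L : Type*} [Field K] [Field L] [Algebra ℚ_[2] L] [Algebra.IsAlgebraic ℚ_[2] L]
  [Algebra K L]

theorem absVal_quadratic_lt_one {σ : Gal(L/K)} {z : L} (hz : absVal L z ≤ 1) {a n : K}
    (ha : absVal L (z + σ z - algebraMap K L a) < 1)
    (hn : absVal L (z * σ z - algebraMap K L n) < 1) :
    absVal L (z ^ 2 - algebraMap K L a * z + algebraMap K L n) < 1 := by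
  rw [show z ^ 2 - algebraMap K L a * z + algebraMap K L n =
    z * (z + σ z - algebraMap K L a) - (z * σ z - algebraMap K L n) by ring]
  refine (absVal_sub_le _ _).trans_lt (max_lt ?_ hn)
  rw [map_mul]
  exact mul_lt_one_of_nonneg_of_lt_one_right hz ((absVal L).nonneg _) ha

variable [Algebra ℚ_[2] K] [IsScalarTower ℚ_[2] K L]

theorem absVal_trace_lt_one_of_sub_lt [Algebra.IsAlgebraic ℚ_[2] K] {s t : Gal(L/K)} {z : L}
    (hz : absVal L z ≤ 1) {a b c : K} (ha : absVal L (z + s z - algebraMap K L a) < 1)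
    (hb : absVal L (z + t z - algebraMap K L b) < 1)
    (hc : absVal L (z + (s * t) z - algebraMap K L c) < 1) (hab : absVal K (a - b) < 1) :
    absVal K c < 1 := by
  have h2z : absVal L (2 * z) < 1 := by
    rw [map_mul]
    exact mul_lt_one_of_nonneg_of_lt_one_left ((absVal L).nonneg _) absVal_two_lt_one hz
  have hsb : absVal L (s (z + t z - algebraMap K L b)) < 1 := by rwa [absVal_algEquiv]
  -- Modulo the maximal ideal, `c = z + stz = (sz + stz) - (z + sz) + 2z = b - a + 0`.
  have hsum : algebraMap K L c = (2 * z - algebraMap K L (a - b)) +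
      ((s (z + t z - algebraMap K L b) - (z + s z - algebraMap K L a)) -
        (z + (s * t) z - algebraMap K L c)) := by
    rw [map_sub s, map_add s, s.commutes, AlgEquiv.mul_apply, map_sub]
    ring
  rw [← absVal_algebraMap (L := L)] at hab ⊢
  rw [hsum]
  exact (absVal_add_le _ _).trans_lt (max_lt ((absVal_sub_le _ _).trans_lt (max_lt h2z hab))
    ((absVal_sub_le _ _).trans_lt (max_lt ((absVal_sub_le _ _).trans_lt (max_lt hsb ha)) hc)))

theorem absVal_sub_lt_one_of_not_hasResidue [Algebra.IsAlgebraic ℚ_[2] K] {z : L}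
    (hres : ¬ HasResidue K z) {a a' n n' : K}
    (h : absVal L (z ^ 2 - algebraMap K L a * z + algebraMap K L n) < 1)
    (h' : absVal L (z ^ 2 - algebraMap K L a' * z + algebraMap K L n') < 1) :
    absVal K (a - a') < 1 := by
  by_contra! hge
  have h0 : algebraMap K L (a - a') ≠ 0 := by
    rw [map_ne_zero]
    rintro h0
    exact hge.not_gt (by rw [h0, map_zero]; exact one_pos)
  have hsub : z - algebraMap K L ((n - n') / (a - a')) =
      ((z ^ 2 - algebraMap K L a' * z + algebraMap K L n') -
        (z ^ 2 - algebraMap K L a * z + algebraMap K L n)) / algebraMap K L (a - a') := by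
    rw [map_div₀, eq_div_iff h0, sub_mul, div_mul_cancel₀ _ h0, map_sub, map_sub]
    ring
  refine hres ⟨(n - n') / (a - a'), ?_⟩
  rw [hsub, map_div₀, absVal_algebraMap]
  exact (div_le_self ((absVal L).nonneg _) hge).trans_lt
    ((absVal_sub_le _ _).trans_lt (max_lt h' h))

variable [FiniteDimensional ℚ_[2] K] [Algebra ℤ_[2] K] [IsScalarTower ℤ_[2] ℚ_[2] K]

theorem HasResidue.of_sq {z : L} (hz : absVal L z ≤ 1) (h : HasResidue K (z ^ 2)) :
    HasResidue K z := by
  obtain ⟨c, hc⟩ := h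
  have hz2 : absVal L (z ^ 2) ≤ 1 := by
    rw [map_pow]
    exact pow_le_one₀ ((absVal L).nonneg _) hz
  have hc1 : absVal K c ≤ 1 := by
    rw [← absVal_algebraMap (F := K) (L := L), ← sub_sub_cancel (z ^ 2) (algebraMap K L c)]
    exact (absVal_sub_le _ _).trans (max_le hz2 hc.le)
  obtain ⟨m, hm⟩ := exists_absVal_sub_sq_lt_one (K := K) ⟨c, (mem_integers_iff_absVal _).2 hc1⟩
  rw [← absVal_algebraMap (F := K) (L := L), map_sub (algebraMap K L), map_pow] at hm
  have hm1 : absVal L (algebraMap K L m) ≤ 1 := by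
    rw [absVal_algebraMap]
    exact absVal_le_one_of_integers m
  have hcross : absVal L (2 * (algebraMap K L m * (z - algebraMap K L m))) < 1 := by
    rw [map_mul]
    refine mul_lt_one_of_nonneg_of_lt_one_left ((absVal L).nonneg _) absVal_two_lt_one ?_
    rw [map_mul]
    exact mul_le_one₀ hm1 ((absVal L).nonneg _) ((absVal_sub_le _ _).trans (max_le hz hm1))
  refine ⟨m, (pow_lt_one_iff_of_nonneg ((absVal L).nonneg _) two_ne_zero).1 ?_⟩
  rw [← map_pow, show (z - algebraMap K L m) ^ 2 = (z ^ 2 - algebraMap K L c) +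
    ((algebraMap K L c - algebraMap K L m ^ 2) -
      2 * (algebraMap K L m * (z - algebraMap K L m))) by ring]
  exact (absVal_add_le _ _).trans_lt
    (max_lt hc ((absVal_sub_le _ _).trans_lt (max_lt hm hcross)))

theorem hasResidue_of_absVal_quadratic_lt_one {z : L} (hz : absVal L z ≤ 1) {a n : K}
    (h : absVal L (z ^ 2 - algebraMap K L a * z + algebraMap K L n) < 1) (ha : absVal K a < 1) :
    HasResidue K z := by
  refine .of_sq hz ⟨-n, ?_⟩
  rw [map_neg, show z ^ 2 - -algebraMap K L n =
    (z ^ 2 - algebraMap K L a * z + algebraMap K L n) + algebraMap K L a * z by ring]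
  refine (absVal_add_le _ _).trans_lt (max_lt h ?_)
  rw [map_mul, absVal_algebraMap]
  exact mul_lt_one_of_nonneg_of_lt_one_left ((absVal K).nonneg _) ha hz

theorem absVal_trace_eq_one_of_not_hasResidue {σ : Gal(L/K)} {w : L} (hw : absVal L w ≤ 1)
    (hres : ¬ HasResidue K w) {T N : K} (hT : algebraMap K L T = w + σ w)
    (hN : algebraMap K L N = w * σ w) : absVal K T = 1 := by
  refine le_antisymm ?_ (le_of_not_gt fun hlt ↦
    hres (hasResidue_of_absVal_quadratic_lt_one (n := N) hw ?_ hlt))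
  · rw [← absVal_algebraMap (F := K) (L := L), hT]
    exact (absVal_add_le _ _).trans (max_le hw ((absVal_algEquiv σ w).trans_le hw))
  · rw [hT, hN, show w ^ 2 - (w + σ w) * w + w * σ w = 0 by ring, map_zero]
    exact one_pos

theorem IsInvolutionPair.exists_sqrt {σ τ : Gal(L/K)} (h : IsInvolutionPair σ τ) {w : L}
    (hw : absVal L w ≤ 1) (hτ : τ w = w) (hres : ¬ HasResidue K w) :
    ∃ (a : Kˣ) (δ : L), δ ^ 2 = algebraMap K L a ∧
      (a : SquareClass K) ∈ classFiltration K 0 ∧ δ ∉ (algebraMap K L).range := by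
  obtain ⟨T, hT⟩ := h.mem_range (w + σ w) (by rw [map_add, ← h.comm, hτ])
    (by rw [map_add, h.left, add_comm])
  obtain ⟨N, hN⟩ := h.mem_range (w * σ w) (by rw [map_mul, ← h.comm, hτ])
    (by rw [map_mul, h.left, mul_comm])
  have hT1 := absVal_trace_eq_one_of_not_hasResidue hw hres hT hN
  have hN1 : absVal K N ≤ 1 := by
    rw [← absVal_algebraMap (F := K) (L := L), hN, map_mul, absVal_algEquiv]
    exact mul_le_one₀ hw ((absVal L).nonneg _) hw
  have hTL : algebraMap K L T ≠ 0 :=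
    (map_ne_zero _).2 ((absVal K).ne_zero_iff.1 (hT1.trans_ne one_ne_zero))
  obtain ⟨a, ha, ha0⟩ := exists_eq_one_sub_four_mul (x := N / T ^ 2)
    (by rwa [map_div₀, map_pow, hT1, one_pow, div_one])
  refine ⟨a, (w - σ w) / algebraMap K L T, ?_, ha0, fun hmem ↦ ?_⟩
  · rw [ha, map_sub, map_one, map_mul, map_div₀, map_pow, map_ofNat, div_pow, hN, ← mul_div_assoc,
      eq_sub_iff_add_eq, ← add_div, div_eq_one_iff_eq (pow_ne_zero _ hTL), hT]
    ring
  · have hfix := apply_eq_of_mem_range hmem σ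
    rw [map_div₀, map_sub, h.left, σ.commutes, div_left_inj' hTL, ← sub_eq_zero,
      show σ w - w - (w - σ w) = -(2 * (w - σ w)) by ring, neg_eq_zero, mul_eq_zero,
      or_iff_right (two_ne_zero_of_algebra_padic L), sub_eq_zero] at hfix
    obtain ⟨c, rfl⟩ := h.mem_range w hτ hfix.symm
    exact hres ⟨c, by simp⟩

theorem exists_not_hasResidue_add_or_mul [IsKleinFour Gal(L/K)] {z : L} (hz : absVal L z ≤ 1)
    (hres : ¬ HasResidue K z) :
    ∃ τ : Gal(L/K), τ ≠ 1 ∧ (¬ HasResidue K (z + τ z) ∨ ¬ HasResidue K (z * τ z)) := by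
  classical
  by_contra! hc
  obtain ⟨s, t, hs, ht, hts, -⟩ := exists_generators_of_isKleinFour Gal(L/K)
  have hst := mul_ne_one_of_isKleinFour hts.symm
  choose! hadd hmul using hc
  choose! a ha using hadd
  choose! n hn using hmul
  have hquad (τ : Gal(L/K)) (hτ : τ ≠ 1) :
      absVal L (z ^ 2 - algebraMap K L (a τ) * z + algebraMap K L (n τ)) < 1 :=
    absVal_quadratic_lt_one hz (ha τ hτ) (hn τ hτ)
  have hsub := absVal_sub_lt_one_of_not_hasResidue hres (hquad s hs) (hquad t ht)
  exact hres (hasResidue_of_absVal_quadratic_lt_one hz (hquad _ hst)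
    (absVal_trace_lt_one_of_sub_lt hz (ha s hs) (ha t ht) (ha _ hst) hsub))

end ResidueField

theorem exists_sqrt_of_not_isTotallyRamified {K L : Type*} [Field K] [Algebra ℚ_[2] K]
    [FiniteDimensional ℚ_[2] K] [Algebra ℤ_[2] K] [IsScalarTower ℤ_[2] ℚ_[2] K]
    [Field L] [Algebra ℚ_[2] L] [FiniteDimensional ℚ_[2] L] [Algebra ℤ_[2] L]
    [IsScalarTower ℤ_[2] ℚ_[2] L] [Algebra K L] [IsScalarTower ℤ_[2] K L]
    [IsScalarTower ℚ_[2] K L] [FiniteDimensional K L] [IsGalois K L] [IsKleinFour Gal(L/K)]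
    (htot : ¬ IsTotallyRamified K L) : ∃ (a : Kˣ) (δ : L), δ ^ 2 = algebraMap K L a ∧
      (a : SquareClass K) ∈ classFiltration K 0 ∧ δ ∉ (algebraMap K L).range := by
  rw [isTotallyRamified_iff_forall_hasResidue] at htot
  push Not at htot
  obtain ⟨z, hz, hres⟩ := htot
  obtain ⟨τ, hτ, hw⟩ := exists_not_hasResidue_add_or_mul hz hres
  obtain ⟨σ, hσ, hστ⟩ : ∃ σ : Gal(L/K), σ ≠ 1 ∧ σ ≠ τ := by
    obtain ⟨s, t, hs, ht, hts, -⟩ := exists_generators_of_isKleinFour Gal(L/K)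
    rcases eq_or_ne s τ with rfl | hsτ
    · exact ⟨t, ht, hts⟩
    · exact ⟨s, hs, hsτ⟩
  have h := isInvolutionPair_of_isKleinFour hσ hτ hστ
  have hτz : absVal L (τ z) ≤ 1 := (absVal_algEquiv τ z).trans_le hz
  rcases hw with hw | hw
  · exact h.exists_sqrt ((absVal_add_le _ _).trans (max_le hz hτz))
      (by rw [map_add, h.right, add_comm]) hw
  · exact h.exists_sqrt (by rw [map_mul]; exact mul_le_one₀ hz ((absVal L).nonneg _) hτz)
      (by rw [map_mul, h.right, mul_comm]) hw
theorem mul_mem_of_ne_of_mul_self {G : Type*} [CommGroup G] [DecidableEq G]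
    (hG : ∀ v : G, v * v = 1) {v w v' w' : G} (hv : v' ∈ ({v, w, v * w} : Finset G))
    (hw : w' ∈ ({v, w, v * w} : Finset G)) (hne : v' ≠ w') :
    v' * w' ∈ ({v, w, v * w} : Finset G) := by
  have hvw : v * (v * w) = w := by rw [← mul_assoc, hG, one_mul]
  have hwv : w * (v * w) = v := by rw [mul_left_comm, hG, mul_one]
  simp only [Finset.mem_insert, Finset.mem_singleton] at hv hw ⊢
  rcases hv with hv | hv | hv <;> rcases hw with hw | hw | hw <;>
    first
    | exact absurd (hv.trans hw.symm) hne
    | simp [hv, hw, hvw, hwv, mul_comm w v, mul_comm (v * w)]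

section Mass

variable {K : Type*} [Field K] [Algebra ℚ_[2] K] [FiniteDimensional ℚ_[2] K]

instance finiteDimensional_padic_biquadraticField (v w : SquareClass K) :
    FiniteDimensional ℚ_[2] (biquadraticField v w) :=
  FiniteDimensional.trans ℚ_[2] K (biquadraticField v w)

variable [Algebra ℤ_[2] K] [IsScalarTower ℤ_[2] ℚ_[2] K] {v w : SquareClass K}

/-- None of the three quadratic extensions of `K` inside `K(√v, √w)` is trivial or unramified.
These are the pairs generating the totally ramified `V₄`-extensions. -/
structure IsRamifiedPair (v w : SquareClass K) : Prop where
  left_notMem : v ∉ classFiltration K 0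
  right_notMem : w ∉ classFiltration K 0
  mul_notMem : v * w ∉ classFiltration K 0

/-- The isomorphism class of `K(√v, √w)`. -/
def biquadraticClass (p : SquareClass K × SquareClass K) : ExtClass K :=
  Quotient.mk (extSetoid K) (biquadraticField p.1 p.2)

namespace IsRamifiedPair

theorem isIndependentPair (h : IsRamifiedPair v w) : IsIndependentPair v w :=
  ⟨fun h1 ↦ h.left_notMem (h1 ▸ one_mem _), fun h1 ↦ h.right_notMem (h1 ▸ one_mem _),
    fun h1 ↦ h.mul_notMem (h1 ▸ one_mem _)⟩

theorem ne (h : IsRamifiedPair v w) : v ≠ w :=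
  fun h1 ↦ h.isIndependentPair.mul_ne_one (h1 ▸ mul_self_squareClass v)

theorem isTotallyRamified (h : IsRamifiedPair v w) :
    IsTotallyRamified K (biquadraticField v w) := by
  have := charZero_of_algebra_padic K
  have := h.isIndependentPair.isKleinFour
  by_contra htot
  obtain ⟨a, δ, hδ, ha, hδ'⟩ := exists_sqrt_of_not_isTotallyRamified htot
  have hmem : sqrtClass (a : SquareClass K) ∈ biquadraticField v w :=
    sqrtClass_mk_mem δ.2 (congrArg Subtype.val hδ)
  rcases h.isIndependentPair.eq_of_sqrtClass_mem hmem with h1 | h1 | h1 | h1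
  · exact hδ' ((mk_eq_one_iff_mem_range hδ).1 h1)
  · exact h.left_notMem (h1 ▸ ha)
  · exact h.right_notMem (h1 ▸ ha)
  · exact h.mul_notMem (h1 ▸ ha)

theorem discrVal_eq (h : IsRamifiedPair v w) : discrVal K (biquadraticField v w) =
    discrExponent K v + discrExponent K w + discrExponent K (v * w) := by
  have := charZero_of_algebra_padic K
  rw [(isBiquadratic_sqrt_iff.2 h.isIndependentPair).discrVal_eq h.isTotallyRamified
    (sqrtLeft_sq v w) (sqrtRight_sq v w), QuotientGroup.mk_mul, mk_out, mk_out]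

theorem massTerm_eq (h : IsRamifiedPair v w) : massTerm K (biquadraticClass (v, w)) =
    4⁻¹ * (ramifiedWeight K v * ramifiedWeight K w * ramifiedWeight K (v * w)) := by
  have := charZero_of_algebra_padic K
  have := h.isIndependentPair.isKleinFour
  change (Nat.card Gal(biquadraticField v w/K) : ℝ)⁻¹ /
    (residueCard K : ℝ) ^ discrVal K (biquadraticField v w) = _
  rw [IsKleinFour.card_four, h.discrVal_eq, ramifiedWeight_of_notMem h.left_notMem,
    ramifiedWeight_of_notMem h.right_notMem, ramifiedWeight_of_notMem h.mul_notMem, ← mul_inv,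
    ← mul_inv, ← pow_add, ← pow_add, div_eq_mul_inv]
  norm_cast

theorem biquadraticClass_mem_totRamQuartics (h : IsRamifiedPair v w) :
    biquadraticClass (v, w) ∈ totRamQuartics K V4 :=
  have := charZero_of_algebra_padic K
  ⟨biquadraticField v w, rfl, h.isIndependentPair.finrank_eq_four, h.isTotallyRamified,
    h.isIndependentPair.hasGaloisClosureGroup⟩

theorem biquadraticClass_eq (h : IsRamifiedPair v w) {v' w' : SquareClass K}
    (h' : IsRamifiedPair v' w') (hv : sqrtClass v ∈ biquadraticField v' w')
    (hw : sqrtClass w ∈ biquadraticField v' w') :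
    biquadraticClass (v, w) = biquadraticClass (v', w') :=
  have := charZero_of_algebra_padic K
  congrArg (Quotient.mk (extSetoid K))
    (h.isIndependentPair.biquadraticField_eq h'.isIndependentPair.finrank_eq_four hv hw)

variable [DecidableEq (SquareClass K)]

theorem notMem_classFiltration_zero (h : IsRamifiedPair v w) {u : SquareClass K}
    (hu : u ∈ ({v, w, v * w} : Finset (SquareClass K))) : u ∉ classFiltration K 0 := by
  simp only [Finset.mem_insert, Finset.mem_singleton] at hu
  rcases hu with rfl | rfl | rfl
  exacts [h.left_notMem, h.right_notMem, h.mul_notMem]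

theorem sqrtClass_mem_iff (h : IsRamifiedPair v w) {u : SquareClass K} (hu : u ≠ 1) :
    sqrtClass u ∈ biquadraticField v w ↔ u ∈ ({v, w, v * w} : Finset (SquareClass K)) := by
  have := charZero_of_algebra_padic K
  simp only [Finset.mem_insert, Finset.mem_singleton]
  refine ⟨fun hmem ↦ (h.isIndependentPair.eq_of_sqrtClass_mem hmem).resolve_left hu, ?_⟩
  rintro (rfl | rfl | rfl)
  exacts [sqrtClass_left_mem _ _, sqrtClass_right_mem _ _,
    sqrtClass_mul_mem (sqrtClass_left_mem _ _) (sqrtClass_right_mem _ _)]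

theorem biquadraticClass_eq_iff (h : IsRamifiedPair v w) {v' w' : SquareClass K} :
    (IsRamifiedPair v' w' ∧ biquadraticClass (v', w') = biquadraticClass (v, w)) ↔
      (v', w') ∈ ({v, w, v * w} : Finset (SquareClass K)).offDiag := by
  rw [Finset.mem_offDiag]
  constructor
  · rintro ⟨h', heq⟩
    obtain ⟨f⟩ := Quotient.exact heq
    exact ⟨(h.sqrtClass_mem_iff h'.isIndependentPair.left_ne_one).1
        (sqrtClass_mem_of_algEquiv f (sqrtClass_left_mem _ _)),
      (h.sqrtClass_mem_iff h'.isIndependentPair.right_ne_one).1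
        (sqrtClass_mem_of_algEquiv f (sqrtClass_right_mem _ _)), h'.ne⟩
  · rintro ⟨hv, hw, hne⟩
    have h' : IsRamifiedPair v' w' :=
      ⟨h.notMem_classFiltration_zero hv, h.notMem_classFiltration_zero hw,
        h.notMem_classFiltration_zero (mul_mem_of_ne_of_mul_self mul_self_squareClass hv hw hne)⟩
    exact ⟨h', h'.biquadraticClass_eq h
      ((h.sqrtClass_mem_iff h'.isIndependentPair.left_ne_one).2 hv)
      ((h.sqrtClass_mem_iff h'.isIndependentPair.right_ne_one).2 hw)⟩

end IsRamifiedPair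

theorem IsIndependentPair.isRamifiedPair (h : IsIndependentPair v w)
    (htot : IsTotallyRamified K (biquadraticField v w)) : IsRamifiedPair v w := by
  have := charZero_of_algebra_padic K
  have hb := isBiquadratic_sqrt_iff.2 h
  have key {z : biquadraticField v w} {a : Kˣ} (hz : z ∉ (algebraMap K _).range)
      (hza : z ^ 2 = algebraMap K _ a) : (a : SquareClass K) ∉ classFiltration K 0 := by
    obtain ⟨σ, hσ⟩ := exists_apply_eq_neg ⟨_, hza.symm⟩ hz
    exact notMem_classFiltration_zero_of_isTotallyRamified htot hza hσ
  refine ⟨?_, ?_, ?_⟩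
  · simpa only [mk_out] using key hb.left_notMem (sqrtLeft_sq v w)
  · simpa only [mk_out] using key hb.right_notMem (sqrtRight_sq v w)
  · simpa only [QuotientGroup.mk_mul, mk_out] using
      key hb.mul_notMem (sqrtLeft_mul_sqrtRight_sq v w)

theorem totRamQuartics_V4_eq : totRamQuartics K V4 =
    biquadraticClass '' {p : SquareClass K × SquareClass K | IsRamifiedPair p.1 p.2} := by
  have := charZero_of_algebra_padic K
  refine Set.Subset.antisymm ?_ ?_
  · rintro _ ⟨L, rfl, hL, htot, hG⟩
    obtain ⟨v, w, h, rfl⟩ := exists_eq_biquadraticField hL hG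
    exact ⟨(v, w), h.isRamifiedPair htot, rfl⟩
  · rintro _ ⟨⟨v, w⟩, h, rfl⟩
    exact h.biquadraticClass_mem_totRamQuartics

theorem finite_totRamQuartics_V4 : (totRamQuartics K V4).Finite := by
  rw [totRamQuartics_V4_eq]
  exact (Set.toFinite _).image _

open Classical in
theorem IsRamifiedPair.card_filter_biquadraticClass_eq (h : IsRamifiedPair v w) :
    (Finset.univ.filter fun p : SquareClass K × SquareClass K ↦
      IsRamifiedPair p.1 p.2 ∧ biquadraticClass p = biquadraticClass (v, w)).card = 6 := by
  have hfilter : (Finset.univ.filter fun p : SquareClass K × SquareClass K ↦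
      IsRamifiedPair p.1 p.2 ∧ biquadraticClass p = biquadraticClass (v, w)) =
        ({v, w, v * w} : Finset (SquareClass K)).offDiag := by
    ext ⟨v', w'⟩
    rw [← h.biquadraticClass_eq_iff, Finset.mem_filter, and_iff_right (Finset.mem_univ _)]
  rw [hfilter, Finset.offDiag_card, Finset.card_eq_three.2 ⟨v, w, v * w, h.ne,
    left_eq_mul.not.2 h.isIndependentPair.right_ne_one,
    right_eq_mul.not.2 h.isIndependentPair.left_ne_one, rfl⟩]

open Classical in
theorem sum_massTerm_biquadraticClass :
    ∑ p : SquareClass K × SquareClass K with IsRamifiedPair p.1 p.2,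
      massTerm K (biquadraticClass p) = 4⁻¹ * subgroupTripleSum (ramifiedWeight K) ⊤ := by
  calc
    _ = ∑ p : SquareClass K × SquareClass K with IsRamifiedPair p.1 p.2, 4⁻¹ *
        (ramifiedWeight K p.1 * ramifiedWeight K p.2 * ramifiedWeight K (p.1 * p.2)) :=
      Finset.sum_congr rfl fun p hp ↦ IsRamifiedPair.massTerm_eq (Finset.mem_filter.1 hp).2
    _ = 4⁻¹ * ∑ p : SquareClass K × SquareClass K,
        ramifiedWeight K p.1 * ramifiedWeight K p.2 * ramifiedWeight K (p.1 * p.2) := by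
      rw [← Finset.mul_sum, Finset.sum_filter_of_ne]
      exact fun p _ hp ↦ ⟨fun h ↦ hp (by rw [ramifiedWeight_of_mem h, zero_mul, zero_mul]),
        fun h ↦ hp (by rw [ramifiedWeight_of_mem h, mul_zero, zero_mul]),
        fun h ↦ hp (by rw [ramifiedWeight_of_mem h, mul_zero])⟩
    _ = _ := by
      rw [subgroupTripleSum, Fintype.sum_prod_type]
      simp only [Subgroup.mem_top, Finset.filter_true]

open Classical in
theorem sum_massTerm_biquadraticClass_eq_mass :
    ∑ p : SquareClass K × SquareClass K with IsRamifiedPair p.1 p.2,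
      massTerm K (biquadraticClass p) = 6 * mass K (totRamQuartics K V4) := by
  set P : Finset (SquareClass K × SquareClass K) :=
    Finset.univ.filter fun p ↦ IsRamifiedPair p.1 p.2 with hP
  have hcoe : totRamQuartics K V4 = (P.image biquadraticClass : Finset (ExtClass K)) := by
    rw [totRamQuartics_V4_eq, Finset.coe_image, hP, Finset.coe_filter_univ]
  rw [mass, hcoe, Finset.tsum_subtype' _ (massTerm K), Finset.sum_comp, Finset.mul_sum]
  refine Finset.sum_congr rfl fun c hc ↦ ?_
  obtain ⟨⟨v, w⟩, hp, rfl⟩ := Finset.mem_image.1 hc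
  have h : IsRamifiedPair v w := (Finset.mem_filter.1 hp).2
  rw [hP, Finset.filter_filter, h.card_filter_biquadraticClass_eq, nsmul_eq_mul, Nat.cast_ofNat]

theorem mass_totRamQuartics_V4 :
    mass K (totRamQuartics K V4) = 24⁻¹ * subgroupTripleSum (ramifiedWeight K) ⊤ := by
  linarith [sum_massTerm_biquadraticClass (K := K), sum_massTerm_biquadraticClass_eq_mass (K := K)]

end Mass

end TwoAdic

end

theorem mainTheorem10 (K : Type*) [Field K] [Algebra ℚ_[2] K] [FiniteDimensional ℚ_[2] K]
    [Algebra ℤ_[2] K] [IsScalarTower ℤ_[2] ℚ_[2] K]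
    (q : ℝ) (hq : q = TwoAdic.residueCard K)
    (e : ℤ) (he : e = TwoAdic.absRamificationIdx K) :
    (TwoAdic.totRamQuartics K TwoAdic.V4).Finite ∧
    TwoAdic.mass K (TwoAdic.totRamQuartics K TwoAdic.V4) =
      (q - 1) / 6 *
        (q ^ (-4 * e - 3) * ((q ^ (4 * e) - 1) / (q ^ 4 - 1)) * (3 * q ^ 3 + q ^ 2 + q + 3) -
          3 * q ^ (-3 * e - 3) * ((q ^ (3 * e) - 1) / (q ^ 3 - 1)) * (q ^ 2 + 1)) := by
  refine ⟨TwoAdic.finite_totRamQuartics_V4, ?_⟩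
  rw [TwoAdic.mass_totRamQuartics_V4, TwoAdic.subgroupTripleSum_ramifiedWeight_top hq he,
    inv_mul_cancel_left₀ (by norm_num)]
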